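/- **Setting.** A contextual bandit is played for $T$ rounds. In round $t$ a context $x_t\in\mathcal X$ is revealed (chosen by an adversary, possibly adaptively from the history $S_{t-1}=[(x_1,a_1,r_1),\dots,(x_{t-1},a_{t-1},r_{t-1})]$ and at random); the player picks $a_t$ in the set $\mathcal A(x_t)$ of allowed actions and observes a reward $r_t\in\mathbb R$ whose conditional law depends only on $(x_t,a_t)$. Put $f_*(x,a)=\mathbb E[r\mid x,a]$ and $f_*(x)=\max_{a\in\mathcal A(x)}f_*(x,a)$. Assume that for all $x$ and $a\in\mathcal A(x)$ we have $f_*(x,a)\in[0,1]$ and $\ln\mathbb E_{r\mid x,a}\exp(\rho(r-f_*(x,a)))\le\rho^2/8$ for all $\rho\in\mathbb R$, and that $|\mathcal A(x)|\le K$ for all $x$. Let $\Omega$ be a parameter space with a prior probability $p_0$ and a function $f(\theta,x,a)$ for each $\theta\in\Omega$ (not assumed to contain $f_*$). Let $a(\theta,x)\in\arg\max_{a\in\mathcal A(x)}f(\theta,x,a)$ and $f(\theta,x)=f(\theta,x,a(\theta,x))$. For $b=1$, $0<\eta\le 0.25$, $\lambda>0$ let $$L(\theta,x,a,r)=\eta(f(\theta,x,a)-r)^2-\lambda\min(b,f(\theta,x)),\qquad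 p(\theta\mid S_{t-1})\propto\exp\Big(-\sum_{s=1}^{t-1}L(\theta,x_s,a_s,r_s)\Big)p_0(\theta).$$ Feel-Good Thompson Sampling draws $\theta_t\sim p(\cdot\mid S_{t-1})$ and plays $a_t=a(\theta_t,x_t)$. Write $f_b(\theta,x,a)=\max(-b,\min(b,f(\theta,x,a)))$, $f_b(\theta,x)=f_b(\theta,x,a(\theta,x))$, and $$\mathrm{REG}_t=f_*(x_t)-f_*(x_t,a_t),\quad \mathrm{LS}_t=(f_b(\tilde\theta,x_t,a_t)-f_*(x_t,a_t))^2,\quad \mathrm{FG}_t=f_b(\theta_t,x_t)-f_*(x_t),$$ where $\tilde\theta\sim p(\cdot\mid S_{t-1})$ is drawn independently of $a_t$ given $S_{t-1}$ and $x_t$, and $$\Delta L(\theta,x,a,r)=\eta[(f(\theta,x,a)-r)^2-(f_*(x,a)-r)^2]-\lambda[\min(b,f(\theta,x))-f_*(x)].$$ **Theorem.** (i) We have $$\sum_{t=1}^T\mathbb E\,\mathrm{REG}_t\le\frac{\lambda KT}{\eta}+\frac{0.25\,\eta}{\lambda}\sum_{t=1}^T\mathbb E\,\mathrm{LS}_t-\sum_{t=1}^T\mathbb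 E\,\mathrm{FG}_t\le\frac{\lambda KT}{\eta}+6\lambda T-\frac1\lambda\,\mathbb E_{S_T}\ln\mathbb E_{\tilde\theta\sim p_0}\exp\Big(-\sum_{s=1}^T\Delta L(\tilde\theta,x_s,a_s,r_s)\Big).$$ The expectation $\mathbb E_{S_T}\ln(\cdots)$ on the right is well defined in $[-\infty,\infty)$; if it is $-\infty$, the last bound is $+\infty$. (ii) (Finite class.) Let $|\Omega|=N$ with $p_0$ uniform, let $T\ge1$ and $\eta=0.25$, and suppose that some $\theta_*\in\Omega$ satisfies $|f(\theta_*,x,a)-f_*(x,a)|\le\delta$ for all $x$ and $a\in\mathcal A(x)$, where $0\le\delta\le 0.5$. If $\delta'>0$ and $\lambda=\frac{\delta'}{\sqrt{K+2}}+\sqrt{\frac{\ln N}{4(K+2)T}}$, then $$\sum_{t=1}^T\mathbb E\,\mathrm{REG}_t\le4\sqrt{(K+2)T\ln N}+4\Big(\delta+\delta'+\frac{\delta^2}{\delta'}\Big)\sqrt{K+2}\;T.$$ If $\delta=0$, $N\ge2$ and $\lambda=\sqrt{\frac{\ln N}{4(K+2)T}}$, then $$\sum_{t=1}^T\mathbb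 E\,\mathrm{REG}_t\le4\sqrt{(K+2)T\ln N}\qquad\text{and}\qquad\sum_{t=1}^T\mathbb E\,\mathrm{REG}_t\le4\sqrt3\,\sqrt{KT\ln N},$$ so the regret is $O(\sqrt{KT\ln N})$. -/

import Mathlib

open MeasureTheory ProbabilityTheory
open scoped ENNReal NNReal

noncomputable section

/-- A contextual bandit: allowed actions `𝒜(x)` for each context, and the conditional law of the
reward, which depends only on the pair (context, action). -/
structure ContextualBandit (X A : Type*) [MeasurableSpace X] [MeasurableSpace A] where
  actions : X → Set A
  reward : Kernel (X × A) ℝ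

namespace ContextualBandit

variable {X A : Type*} [MeasurableSpace X] [MeasurableSpace A] (B : ContextualBandit X A)

/-- The true value function `f_*(x,a) = E[r | x, a]`. -/
def fstar (x : X) (a : A) : ℝ := ∫ r, r ∂(B.reward (x, a))

/-- The maximal expected reward `f_*(x) = max_{a ∈ 𝒜(x)} f_*(x,a)`. -/
def optValue (x : X) : ℝ := sSup (B.fstar x '' B.actions x)

/-- The reward assumption: the noise `r - f_*(x,a)` satisfies
`ln E exp(ρ (r - f_*(x,a))) ≤ ρ² / 8` for all real `ρ` (variance proxy `1/4`),
and `f_*(x,a) ∈ [0,1]`, for all contexts and allowed actions. -/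
def RewardAssumption : Prop :=
  ∀ x, ∀ a ∈ B.actions x,
    HasSubgaussianMGF (fun r => r - B.fstar x a) (1 / 4 : ℝ≥0) (B.reward (x, a)) ∧
      B.fstar x a ∈ Set.Icc (0 : ℝ) 1

end ContextualBandit

/-- A family of value functions `f(θ,x,a)`, with an induced (greedy) action
`a(θ,x) ∈ argmax_{a ∈ 𝒜(x)} f(θ,x,a)`. No relation between `f` and `f_*` is required. -/
structure ValueModel {X A : Type*} [MeasurableSpace X] [MeasurableSpace A]
    (B : ContextualBandit X A) (Θ : Type*) [MeasurableSpace Θ] where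
  f : Θ → X → A → ℝ
  measurable_f : Measurable fun z : Θ × X × A => f z.1 z.2.1 z.2.2
  greedy : Θ → X → A
  measurable_greedy : Measurable fun z : Θ × X => greedy z.1 z.2
  greedy_mem : ∀ θ x, greedy θ x ∈ B.actions x
  greedy_max : ∀ θ x, ∀ a ∈ B.actions x, f θ x a ≤ f θ x (greedy θ x)

/-- The history `S_t` of the first `t` rounds, a list of `t` triples (context, action, reward). -/
abbrev History (X A : Type*) (t : ℕ) : Type _ := Fin t → X × A × ℝ

namespace ValueModel

variable {X A Θ : Type*} [MeasurableSpace X] [MeasurableSpace A] [MeasurableSpace Θ]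
  {B : ContextualBandit X A} (M : ValueModel B Θ)

/-- `f(θ,x) = f(θ,x,a(θ,x)) = max_a f(θ,x,a)`. -/
def value (θ : Θ) (x : X) : ℝ := M.f θ x (M.greedy θ x)

/-- `f_b(θ,x,a) = max(-b, min(b, f(θ,x,a)))`. -/
def trunc (b : ℝ) (θ : Θ) (x : X) (a : A) : ℝ := max (-b) (min b (M.f θ x a))

/-- `f_b(θ,x) = f_b(θ,x,a(θ,x))`. -/
def truncValue (b : ℝ) (θ : Θ) (x : X) : ℝ := M.trunc b θ x (M.greedy θ x)

/-- The Feel-Good loss `L(θ,x,a,r) = η (f(θ,x,a) - r)² - λ min(b, f(θ,x))`. -/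
def loss (η lam b : ℝ) (θ : Θ) (z : X × A × ℝ) : ℝ :=
  η * (M.f θ z.1 z.2.1 - z.2.2) ^ 2 - lam * min b (M.value θ z.1)

/-- The excess loss `ΔL(θ,x,a,r) =
η [(f(θ,x,a) - r)² - (f_*(x,a) - r)²] - λ [min(b, f(θ,x)) - f_*(x)]`. -/
def excessLoss (η lam b : ℝ) (θ : Θ) (z : X × A × ℝ) : ℝ :=
  η * ((M.f θ z.1 z.2.1 - z.2.2) ^ 2 - (B.fstar z.1 z.2.1 - z.2.2) ^ 2)
    - lam * (min b (M.value θ z.1) - B.optValue z.1)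

theorem measurable_loss (η lam b : ℝ) :
    Measurable fun p : Θ × (X × A × ℝ) => M.loss η lam b p.1 p.2 := by
  have h1 : Measurable fun p : Θ × (X × A × ℝ) => M.f p.1 p.2.1 p.2.2.1 :=
    M.measurable_f.comp (g := fun z : Θ × X × A => M.f z.1 z.2.1 z.2.2)
      (f := fun p : Θ × (X × A × ℝ) => (p.1, p.2.1, p.2.2.1)) (by fun_prop)
  have hg : Measurable fun p : Θ × (X × A × ℝ) => M.greedy p.1 p.2.1 :=
    M.measurable_greedy.comp (g := fun z : Θ × X => M.greedy z.1 z.2)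
      (f := fun p : Θ × (X × A × ℝ) => (p.1, p.2.1)) (by fun_prop)
  have h2 : Measurable fun p : Θ × (X × A × ℝ) => M.f p.1 p.2.1 (M.greedy p.1 p.2.1) :=
    M.measurable_f.comp (g := fun z : Θ × X × A => M.f z.1 z.2.1 z.2.2)
      (f := fun p : Θ × (X × A × ℝ) => (p.1, p.2.1, M.greedy p.1 p.2.1)) (by fun_prop)
  unfold loss value
  fun_prop

/-- The posterior `p(θ | S) ∝ exp(-∑_s L(θ, x_s, a_s, r_s)) p₀(θ)` given a history `S` of
length `t`, as a kernel from histories to parameters. -/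
def posterior (p₀ : Measure Θ) [IsProbabilityMeasure p₀] (η lam b : ℝ) (t : ℕ) :
    Kernel (History X A t) Θ where
  toFun S := p₀.tilted fun θ => -∑ s, M.loss η lam b θ (S s)
  measurable' := by
    have hm : Measurable fun p : History X A t × Θ =>
        Real.exp (-∑ s, M.loss η lam b p.2 (p.1 s)) := by
      refine Real.measurable_exp.comp (Measurable.neg ?_)
      refine Finset.measurable_fun_sum _ fun s _ => ?_
      exact (M.measurable_loss η lam b).comp
        (f := fun p : History X A t × Θ => (p.2, p.1 s)) (by fun_prop)
    have hi : Measurable fun S : History X A t =>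
        ∫ θ, Real.exp (-∑ s, M.loss η lam b θ (S s)) ∂p₀ :=
      (hm.stronglyMeasurable.integral_prod_right (ν := p₀)).measurable
    refine Measure.measurable_of_measurable_coe _ fun E hE => ?_
    simp only [tilted_apply' _ _ hE]
    have hq : Measurable (Function.uncurry fun (S : History X A t) (θ : Θ) =>
        ENNReal.ofReal (Real.exp (-∑ s, M.loss η lam b θ (S s)) /
          ∫ θ, Real.exp (-∑ s, M.loss η lam b θ (S s)) ∂p₀)) :=
      (hm.div (hi.comp measurable_fst)).ennreal_ofReal
    exact hq.lintegral_prod_right'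

end ValueModel

section Game

variable {X A Θ Ω : Type*} [MeasurableSpace X] [MeasurableSpace A] [MeasurableSpace Θ]
  [MeasurableSpace Ω] {B : ContextualBandit X A}

/-- The random history of rounds `0, …, t-1`, when the contexts are `x`, the sampled parameters
are `θ`, the actions are `a_s = a(θ_s, x_s)` and the rewards are `r`. -/
def history (M : ValueModel B Θ) (x : ℕ → Ω → X) (θ : ℕ → Ω → Θ) (r : ℕ → Ω → ℝ)
    (t : ℕ) (ω : Ω) : History X A t :=
  fun s => (x s ω, M.greedy (θ s ω) (x s ω), r s ω)

/-- `T` rounds (numbered `0, …, T-1`) of Feel-Good Thompson Sampling: in round `t` an arbitrary,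
possibly adaptive and randomised, context `x_t` is revealed; the player draws `θ_t` from the
posterior given the history of the previous rounds and plays `a_t = a(θ_t, x_t)`; the reward
`r_t` then follows the reward law of `(x_t, a_t)`. -/
structure IsFeelGoodTS (M : ValueModel B Θ) (p₀ : Measure Θ) [IsProbabilityMeasure p₀]
    (η lam b : ℝ) (T : ℕ) (P : Measure Ω)
    (x : ℕ → Ω → X) (θ : ℕ → Ω → Θ) (r : ℕ → Ω → ℝ) : Prop where
  measurable_x : ∀ t < T, Measurable (x t)
  measurable_θ : ∀ t < T, Measurable (θ t)
  measurable_r : ∀ t < T, Measurable (r t)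
  param_law : ∀ t < T,
    HasCondDistrib (θ t) (fun ω => (history M x θ r t ω, x t ω))
      (Kernel.prodMkRight X (M.posterior p₀ η lam b t)) P
  reward_law : ∀ t < T,
    HasCondDistrib (r t)
      (fun ω => (history M x θ r t ω, (x t ω, M.greedy (θ t ω) (x t ω))))
      (Kernel.prodMkLeft (History X A t) B.reward) P

variable (M : ValueModel B Θ) (P : Measure Ω)
  (x : ℕ → Ω → X) (θ : ℕ → Ω → Θ) (r : ℕ → Ω → ℝ)

/-- `E REG_t`, where `REG_t = f_*(x_t) - f_*(x_t, a_t)`. -/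
def expReg (t : ℕ) : ℝ :=
  ∫ ω, (B.optValue (x t ω) - B.fstar (x t ω) (M.greedy (θ t ω) (x t ω))) ∂P

/-- `E LS_t`, where `LS_t = (f_b(θ', x_t, a_t) - f_*(x_t, a_t))²` and `θ'` is a fresh draw from
the posterior given the history before round `t`, independent of `a_t`. -/
def expLS (p₀ : Measure Θ) [IsProbabilityMeasure p₀] (η lam b : ℝ) (t : ℕ) : ℝ :=
  ∫ ω, (∫ θ', (M.trunc b θ' (x t ω) (M.greedy (θ t ω) (x t ω))
      - B.fstar (x t ω) (M.greedy (θ t ω) (x t ω))) ^ 2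
    ∂(M.posterior p₀ η lam b t (history M x θ r t ω))) ∂P

/-- `E FG_t`, where `FG_t = f_b(θ_t, x_t) - f_*(x_t)`. -/
def expFG (b : ℝ) (t : ℕ) : ℝ :=
  ∫ ω, (M.truncValue b (θ t ω) (x t ω) - B.optValue (x t ω)) ∂P

/-- `ln E_{θ' ∼ p₀} exp(-∑_{s} ΔL(θ', x_s, a_s, r_s))`, the sum being over the first `T` rounds,
as a random variable. -/
def logPartition (p₀ : Measure Θ) (η lam b : ℝ) (T : ℕ) (ω : Ω) : ℝ :=
  Real.log (∫ θ', Real.exp (-∑ s, M.excessLoss η lam b θ' (history M x θ r T ω s)) ∂p₀)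

/-- The expectation `E Z⁺ - E Z⁻ ∈ [-∞, ∞]` of a real random variable; it is the standard one
whenever `E Z⁺ < ∞` or `E Z⁻ < ∞`. -/
def extExpectation (Z : Ω → ℝ) : EReal :=
  ((∫⁻ ω, ENNReal.ofReal (Z ω) ∂P : ℝ≥0∞) : EReal)
    - ((∫⁻ ω, ENNReal.ofReal (-Z ω) ∂P : ℝ≥0∞) : EReal)

end Game

end

/-!
The proof bounds the regret in two steps, each of them one round at a time.

*Decoupling.* The regret of a round is the prediction error `f_b(θ_t, x_t, a_t) - f_*(x_t, a_t)`
minus the Feel-Good term `FG_t`. In the prediction error the action depends on the parameter. If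
the posterior plays `a` with probability `p(a)`, then `h ≤ 1 / (4 c p(a)) + c p(a) h²` on the event
that `a` is played; summing over the at most `K` actions leaves `K / (4 c)` plus `c` times the
squared error of an independent posterior draw (`integral_le_card_add_decoupled_sq`). The choice
`c = η / (4 λ)` gives `IsFeelGoodTS.expReg_le`.

*Potential.* Replacing the loss by the excess loss does not change the posterior, so the partition
function `Z_t = E_{p₀} exp(-∑_{s<t} ΔL_s)` satisfies
`log Z_{t+1} - log Z_t = log E_{post} exp(U + λ V)`, up to truncation, where `-U` is the excess
square loss and `V` the Feel-Good term. The pointwise inequality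
`exp(U + λV - m) ≤ (exp(2U) + exp(2(λV - m))) / 2`, together with Hoeffding's lemma for `V` and
`log y ≤ y - 1`, bounds this by `(E exp(2U) - 1) / 2 + λ E V + 9/4 λ²`
(`log_integral_exp_add_le`). This bound is linear in `exp(2U)`, so the expectation over the
sub-Gaussian reward can be taken directly (`lintegral_exp_excess_sq_le`), and produces
`-η/4 LS_t + λ FG_t + 9/4 λ²`. Thus `log Z_T` lies *pointwise* below a sum of integrable variables
(`IsFeelGoodTS.exists_integrable_majorant`). This proves that its expectation is well defined and
yields the second inequality without assuming that the increments of `log Z_t` are integrable.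

For a finite class, `Z_T` is at least the contribution `exp(-∑ ΔL(θ_*)) / N` of the parameter
`θ_*`, whose excess loss has expectation at most `η δ² + λ δ` because the noise is centred
(`IsFeelGoodTS.exists_integrable_minorant`). The stated `λ` balances the resulting terms
(`balanced_sqrt`).
-/

/-! ### Disintegration along a conditional distribution -/

section Disintegration

variable {Ω E F : Type*} [MeasurableSpace Ω] [MeasurableSpace E] [MeasurableSpace F]
  {P : Measure Ω} [SFinite P] {U : Ω → E} {V : Ω → F} {κ : Kernel E F} [IsSFiniteKernel κ]

theorem ProbabilityTheory.HasCondDistrib.lintegral_comp_prodMk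
    (h : HasCondDistrib V U κ P) {G : E × F → ℝ≥0∞} (hG : Measurable G) :
    ∫⁻ ω, G (U ω, V ω) ∂P = ∫⁻ ω, ∫⁻ y, G (U ω, y) ∂(κ (U ω)) ∂P := by
  rw [← lintegral_map' hG.aemeasurable h.aemeasurable, h.map_eq,
    Measure.lintegral_compProd hG,
    lintegral_map' hG.lintegral_kernel_prod_right'.aemeasurable h.aemeasurable_fst]

theorem ProbabilityTheory.HasCondDistrib.integral_comp_prodMk
    (h : HasCondDistrib V U κ P) {G : E × F → ℝ} (hG : Measurable G)
    (hi : Integrable (fun ω => G (U ω, V ω)) P) :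
    ∫ ω, G (U ω, V ω) ∂P = ∫ ω, ∫ y, G (U ω, y) ∂(κ (U ω)) ∂P := by
  have hGi : Integrable G ((P.map U) ⊗ₘ κ) := by
    rw [← h.map_eq]
    exact (integrable_map_measure hG.aestronglyMeasurable h.aemeasurable).2 hi
  rw [← integral_map h.aemeasurable hG.aestronglyMeasurable, h.map_eq,
    Measure.integral_compProd hGi,
    integral_map h.aemeasurable_fst]
  exact (hG.stronglyMeasurable.integral_kernel_prod_right' (κ := κ)).aestronglyMeasurable

end Disintegration

/-! ### Decoupling a random action from the parameter that chose it -/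

section Decoupling

variable {Θ A : Type*} [MeasurableSpace Θ] [MeasurableSpace A] [MeasurableSingletonClass A]
  {ν : Measure Θ}

theorem integral_eq_sum_setIntegral_fiber {q : Θ → A} (hq : Measurable q) {s : Finset A}
    (hs : ∀ θ, q θ ∈ s) {h : Θ → A → ℝ} (hi : ∀ a ∈ s, Integrable (fun θ => h θ a) ν) :
    ∫ θ, h θ (q θ) ∂ν = ∑ a ∈ s, ∫ θ in q ⁻¹' {a}, h θ a ∂ν := by
  classical
  have hm : ∀ a, MeasurableSet (q ⁻¹' {a}) := fun a => hq (measurableSet_singleton a)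
  calc ∫ θ, h θ (q θ) ∂ν
      = ∫ θ, ∑ a ∈ s, (q ⁻¹' {a}).indicator (fun θ => h θ a) θ ∂ν := by
        congr 1
        ext θ
        rw [Finset.sum_eq_single (q θ)]
        · simp
        · intro a _ ha
          simp [Ne.symm ha]
        · exact fun hn => absurd (hs θ) hn
    _ = ∑ a ∈ s, ∫ θ in q ⁻¹' {a}, h θ a ∂ν := by
        rw [integral_finsetSum _ fun a ha => (hi a ha).indicator (hm a)]
        exact Finset.sum_congr rfl fun a _ => integral_indicator (hm a)

/-- A random action `q θ` with at most `s.card` values can be decoupled from `θ`, at the price of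
passing to squares: on the fibre `q = a`, of probability `p`, apply
`h ≤ 1 / (4cp) + cp h²` and drop the restriction to the fibre in the quadratic term. -/
theorem integral_le_card_add_decoupled_sq [IsProbabilityMeasure ν] {q : Θ → A}
    (hq : Measurable q) {s : Finset A}
    (hs : ∀ θ, q θ ∈ s) {h : Θ → A → ℝ} (hi : ∀ a ∈ s, Integrable (fun θ => h θ a) ν)
    (hi2 : ∀ a ∈ s, Integrable (fun θ => h θ a ^ 2) ν) {c : ℝ} (hc : 0 < c) :
    ∫ θ, h θ (q θ) ∂ν ≤ s.card / (4 * c) + c * ∫ θ, ∫ θ', h θ' (q θ) ^ 2 ∂ν ∂ν := by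
  have hm : ∀ a, MeasurableSet (q ⁻¹' {a}) := fun a => hq (measurableSet_singleton a)
  rw [integral_eq_sum_setIntegral_fiber hq hs hi,
    integral_eq_sum_setIntegral_fiber (h := fun _ a => ∫ θ', h θ' a ^ 2 ∂ν) hq hs
      fun a _ => integrable_const _]
  have key : ∀ a ∈ s, ∫ θ in q ⁻¹' {a}, h θ a ∂ν
      ≤ 1 / (4 * c) + c * ∫ _ in q ⁻¹' {a}, ∫ θ', h θ' a ^ 2 ∂ν ∂ν := by
    intro a ha
    have hcst : ∫ _ in q ⁻¹' {a}, ∫ θ', h θ' a ^ 2 ∂ν ∂ν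
        = ν.real (q ⁻¹' {a}) * ∫ θ', h θ' a ^ 2 ∂ν := by
      simp
    rw [hcst]
    set p := ν.real (q ⁻¹' {a}) with hp
    have hI : 0 ≤ ∫ θ', h θ' a ^ 2 ∂ν := integral_nonneg fun _ => sq_nonneg _
    have hp0 : 0 ≤ p := measureReal_nonneg
    rcases hp0.eq_or_lt with h0 | h0
    · have hz : ν (q ⁻¹' {a}) = 0 := by
        rwa [eq_comm, hp, measureReal_eq_zero_iff] at h0
      rw [setIntegral_measure_zero _ hz, ← h0]
      simp only [zero_mul, mul_zero, add_zero]
      positivity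
    · calc ∫ θ in q ⁻¹' {a}, h θ a ∂ν
          ≤ ∫ θ in q ⁻¹' {a}, (1 / (4 * c * p) + c * p * h θ a ^ 2) ∂ν := by
            refine setIntegral_mono (hi a ha).integrableOn ?_ fun θ => ?_
            · exact (integrable_const _).add ((hi2 a ha).integrableOn.const_mul _)
            -- completing the square
            · have hcp : 0 < c * p := mul_pos hc h0
              have : h θ a = 1 / (4 * c * p) + c * p * h θ a ^ 2
                  - c * p * (h θ a - 1 / (2 * (c * p))) ^ 2 := by
                field_simp
                ring
              nlinarith [mul_nonneg hcp.le (sq_nonneg (h θ a - 1 / (2 * (c * p))))]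
        _ = 1 / (4 * c) + c * p * ∫ θ in q ⁻¹' {a}, h θ a ^ 2 ∂ν := by
            rw [integral_add (integrable_const _) ((hi2 a ha).integrableOn.const_mul _),
              integral_const_mul, setIntegral_const, ← hp, smul_eq_mul]
            field_simp
        _ ≤ 1 / (4 * c) + c * (p * ∫ θ', h θ' a ^ 2 ∂ν) := by
            rw [mul_assoc]
            gcongr
            · exact .of_forall fun θ => sq_nonneg (h θ a)
            · exact hi2 a ha
            · exact Measure.restrict_le_self
  calc ∑ a ∈ s, ∫ θ in q ⁻¹' {a}, h θ a ∂ν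
      ≤ ∑ a ∈ s, (1 / (4 * c) + c * ∫ _ in q ⁻¹' {a}, ∫ θ', h θ' a ^ 2 ∂ν ∂ν) :=
        Finset.sum_le_sum key
    _ = _ := by
        rw [Finset.sum_add_distrib, ← Finset.mul_sum, Finset.sum_const, nsmul_eq_mul]
        ring

end Decoupling

/-! ### Exponential moment bounds -/

/-- The exponential moment of `U + λV`: since
`exp (U + λV - m) ≤ (exp (2U) + exp (2 (λV - m))) / 2` and `log y ≤ y - 1`, the two terms separate.
The shift `m` is chosen so that Hoeffding's lemma gives `E exp (2 (λV - m)) ≤ 1`. -/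
theorem log_integral_exp_add_le {Θ : Type*} [MeasurableSpace Θ] {ν : Measure Θ}
    [IsProbabilityMeasure ν] {U V : Θ → ℝ} (hU : Measurable U) (hV : Measurable V)
    {C : ℝ} (hUC : ∀ θ, U θ ≤ C) (hVb : ∀ θ, V θ ∈ Set.Icc (-2 : ℝ) 1) (lam : ℝ) :
    Real.log (∫ θ, Real.exp (U θ + lam * V θ) ∂ν)
      ≤ (∫ θ, Real.exp (2 * U θ) ∂ν - 1) / 2 + lam * ∫ θ, V θ ∂ν + 9 / 4 * lam ^ 2 := by
  have hsub := hasSubgaussianMGF_of_mem_Icc (μ := ν) hV.aemeasurable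
    (Filter.Eventually.of_forall hVb)
  have hmgf := hsub.mgf_le (2 * lam)
  have hVi := hsub.integrable_exp_mul (2 * lam)
  set v := ∫ θ, V θ ∂ν with hv
  set m := lam * v + 9 / 4 * lam ^ 2 with hm
  have hc : (((‖(1 : ℝ) - (-2)‖₊ / 2) ^ 2 : ℝ≥0) : ℝ) * (2 * lam) ^ 2 / 2 = 9 / 2 * lam ^ 2 := by
    have : ‖(1 : ℝ) - (-2)‖ = 3 := by norm_num
    push_cast
    rw [this]
    ring
  rw [hc, mgf] at hmgf
  have hV2 : ∀ θ, Real.exp (2 * (lam * V θ - m))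
      = Real.exp (-(9 / 2 * lam ^ 2)) * Real.exp (2 * lam * (V θ - v)) := by
    intro θ
    rw [← Real.exp_add]
    congr 1
    rw [hm]
    ring
  have hVle : ∫ θ, Real.exp (2 * (lam * V θ - m)) ∂ν ≤ 1 := by
    simp_rw [hV2]
    rw [integral_const_mul]
    calc _ ≤ Real.exp (-(9 / 2 * lam ^ 2)) * Real.exp (9 / 2 * lam ^ 2) := by gcongr
      _ = 1 := by rw [← Real.exp_add]; simp
  have hVint : Integrable (fun θ => Real.exp (2 * (lam * V θ - m))) ν := by
    simp_rw [hV2]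
    exact hVi.const_mul _
  have hUint : Integrable (fun θ => Real.exp (2 * U θ)) ν := by
    refine Integrable.of_bound (by fun_prop) (Real.exp (2 * C)) (.of_forall fun θ => ?_)
    rw [Real.norm_eq_abs, Real.abs_exp, Real.exp_le_exp]
    linarith [hUC θ]
  have hpt : ∀ θ, Real.exp (U θ + lam * V θ)
      ≤ Real.exp m * ((Real.exp (2 * U θ) + Real.exp (2 * (lam * V θ - m))) / 2) := by
    intro θ
    have h1 : Real.exp (U θ + lam * V θ)
        = Real.exp m * (Real.exp (U θ) * Real.exp (lam * V θ - m)) := by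
      rw [← Real.exp_add, ← Real.exp_add]
      congr 1
      ring
    have h2 : Real.exp (2 * U θ) = Real.exp (U θ) ^ 2 := by
      rw [← Real.exp_nat_mul]; norm_num
    have h3 : Real.exp (2 * (lam * V θ - m)) = Real.exp (lam * V θ - m) ^ 2 := by
      rw [← Real.exp_nat_mul]; norm_num
    rw [h1, h2, h3]
    gcongr
    nlinarith [sq_nonneg (Real.exp (U θ) - Real.exp (lam * V θ - m))]
  have hRint : Integrable (fun θ =>
      Real.exp m * ((Real.exp (2 * U θ) + Real.exp (2 * (lam * V θ - m))) / 2)) ν :=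
    ((hUint.add hVint).div_const 2).const_mul _
  have hLint : Integrable (fun θ => Real.exp (U θ + lam * V θ)) ν := by
    refine hRint.mono' (by fun_prop) (.of_forall fun θ => ?_)
    rw [Real.norm_eq_abs, Real.abs_exp]
    exact hpt θ
  have hW : ∫ θ, Real.exp (U θ + lam * V θ) ∂ν
      ≤ Real.exp m * ((∫ θ, Real.exp (2 * U θ) ∂ν + 1) / 2) := by
    refine (integral_mono hLint hRint hpt).trans ?_
    rw [integral_const_mul, integral_div, integral_add hUint hVint]
    gcongr
  have hWpos : 0 < ∫ θ, Real.exp (U θ + lam * V θ) ∂ν := integral_exp_pos hLint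
  have hA : 0 ≤ ∫ θ, Real.exp (2 * U θ) ∂ν := integral_nonneg fun _ => (Real.exp_pos _).le
  calc Real.log (∫ θ, Real.exp (U θ + lam * V θ) ∂ν)
      ≤ Real.log (Real.exp m * ((∫ θ, Real.exp (2 * U θ) ∂ν + 1) / 2)) :=
        Real.log_le_log hWpos hW
    _ = m + Real.log ((∫ θ, Real.exp (2 * U θ) ∂ν + 1) / 2) := by
        rw [Real.log_mul (Real.exp_pos m).ne' (by positivity), Real.log_exp]
    _ ≤ m + ((∫ θ, Real.exp (2 * U θ) ∂ν + 1) / 2 - 1) := by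
        gcongr
        exact Real.log_le_sub_one_of_pos (by positivity)
    _ = _ := by rw [hm]; ring

/-- On `[0, 3/2]` the exponential `exp (-v)` lies below the line `1 - v / 3`. -/
theorem exp_neg_le_one_sub_div_three {v : ℝ} (h0 : 0 ≤ v) (h1 : v ≤ 3 / 2) :
    Real.exp (-v) ≤ 1 - v / 3 := by
  have hq := Real.quadratic_le_exp_of_nonneg h0
  rw [Real.exp_neg]
  refine inv_le_of_inv_le₀ (by linarith) ?_
  refine le_trans ?_ hq
  rw [inv_le_iff_one_le_mul₀ (by linarith)]
  nlinarith [mul_nonneg h0 h0, mul_nonneg h0 (sub_nonneg.2 h1)]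

/-- Truncating a prediction to `[-1, 1]` brings it closer to any target in `[0, 1]`. -/
theorem sq_trunc_sub_le {y c : ℝ} (hc : c ∈ Set.Icc (0 : ℝ) 1) :
    (max (-1) (min 1 y) - c) ^ 2 ≤ (y - c) ^ 2 := by
  obtain ⟨h0, h1⟩ := hc
  rcases le_total y 1 with h | h
  · rw [min_eq_right h]
    rcases le_total (-1) y with h' | h'
    · rw [max_eq_right h']
    · rw [max_eq_left h']
      nlinarith
  · rw [min_eq_left h, max_eq_right (by norm_num)]
    nlinarith

theorem trunc_sub_mem_Icc {y c : ℝ} (hc : c ∈ Set.Icc (0 : ℝ) 1) :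
    max (-1) (min 1 y) - c ∈ Set.Icc (-2 : ℝ) 1 := by
  have h1 : max (-1) (min 1 y) ≤ 1 := max_le (by norm_num) (min_le_left _ _)
  have h2 : -1 ≤ max (-1) (min 1 y) := le_max_left _ _
  constructor <;> linarith [hc.1, hc.2]

theorem sq_trunc_sub_le_four {y c : ℝ} (hc : c ∈ Set.Icc (0 : ℝ) 1) :
    (max (-1) (min 1 y) - c) ^ 2 ≤ 4 := by
  have h := trunc_sub_mem_Icc (y := y) hc
  nlinarith [h.1, h.2]

/-- The exponential moment of the excess square loss under sub-Gaussian noise: the cross term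
contributes `2η²(y - c)²`, which for `η ≤ 1/4` leaves `-3/2 η (y - c)²` in the exponent. -/
theorem lintegral_exp_excess_sq_le {μ : Measure ℝ} {c : ℝ}
    (hμ : HasSubgaussianMGF (fun r => r - c) (1 / 4 : ℝ≥0) μ) (hc : c ∈ Set.Icc (0 : ℝ) 1)
    {η : ℝ} (hη : 0 < η) (hη' : η ≤ 1 / 4) (y : ℝ) :
    ∫⁻ r, ENNReal.ofReal (Real.exp (2 * -(η * ((y - r) ^ 2 - (c - r) ^ 2)))) ∂μ
      ≤ ENNReal.ofReal (1 - η / 2 * (max (-1) (min 1 y) - c) ^ 2) := by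
  have hmgf := hμ.mgf_le (4 * η * (y - c))
  have hint := hμ.integrable_exp_mul (4 * η * (y - c))
  have hpt : ∀ r, Real.exp (2 * -(η * ((y - r) ^ 2 - (c - r) ^ 2)))
      = Real.exp (-(2 * η * (y - c) ^ 2)) * Real.exp (4 * η * (y - c) * (r - c)) := by
    intro r
    rw [← Real.exp_add]
    congr 1
    ring
  simp_rw [hpt]
  rw [← ofReal_integral_eq_lintegral_ofReal (hint.const_mul _) (.of_forall fun r => by positivity),
    integral_const_mul]
  refine ENNReal.ofReal_le_ofReal ?_
  have hq : 0 ≤ (y - c) ^ 2 := sq_nonneg _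
  set d := (max (-1) (min 1 y) - c) ^ 2 with hd
  have hd0 : 0 ≤ d := sq_nonneg _
  calc _ ≤ Real.exp (-(2 * η * (y - c) ^ 2))
          * Real.exp (((1 / 4 : ℝ≥0) : ℝ) * (4 * η * (y - c)) ^ 2 / 2) := by
        gcongr
        exact hmgf
    _ = Real.exp (-(2 * η * (1 - η) * (y - c) ^ 2)) := by
        rw [← Real.exp_add]
        congr 1
        push_cast
        ring
    _ ≤ Real.exp (-(3 / 2 * η * d)) := by
        rw [Real.exp_le_exp, neg_le_neg_iff]
        have : 3 / 2 * η ≤ 2 * η * (1 - η) := by nlinarith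
        calc _ ≤ 3 / 2 * η * (y - c) ^ 2 := by gcongr; exact sq_trunc_sub_le hc
          _ ≤ _ := by gcongr
    _ ≤ 1 - (3 / 2 * η * d) / 3 := by
        refine exp_neg_le_one_sub_div_three (by positivity) ?_
        have := sq_trunc_sub_le_four (y := y) hc
        nlinarith
    _ = _ := by ring

theorem integral_const_add_mul {E : Type*} [MeasurableSpace E] {μ : Measure E}
    [IsProbabilityMeasure μ] {f : E → ℝ} (hf : Integrable f μ) (k c : ℝ) :
    ∫ e, (k + c * f e) ∂μ = k + c * ∫ e, f e ∂μ := by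
  rw [integral_add (integrable_const k) (hf.const_mul c), integral_const_mul, integral_const,
    probReal_univ, one_smul]

theorem lintegral_ofReal_one_sub_mul {E : Type*} [MeasurableSpace E] {μ : Measure E}
    [IsProbabilityMeasure μ] {f : E → ℝ} (hf : Integrable f μ) {c : ℝ}
    (h : ∀ e, c * f e ≤ 1) :
    ∫⁻ e, ENNReal.ofReal (1 - c * f e) ∂μ = ENNReal.ofReal (1 - c * ∫ e, f e ∂μ) := by
  have hi : Integrable (fun e => 1 - c * f e) μ := (integrable_const 1).sub (hf.const_mul c)
  rw [← ofReal_integral_eq_lintegral_ofReal hi (.of_forall fun e => sub_nonneg.2 (h e))]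
  congr 1
  simpa [sub_eq_add_neg] using integral_const_add_mul hf 1 (-c)

/-- The first absolute moment of a sub-Gaussian variable is bounded in terms of its variance
proxy alone. -/
theorem lintegral_enorm_le_of_hasSubgaussianMGF {E : Type*} [MeasurableSpace E] {μ : Measure E}
    {Y : E → ℝ} {c : ℝ≥0} (h : HasSubgaussianMGF Y c μ) :
    ∫⁻ y, ‖Y y‖ₑ ∂μ ≤ ENNReal.ofReal (2 * Real.exp (c / 2)) := by
  have h1 := h.integrable_exp_mul 1
  have h2 := h.integrable_exp_mul (-1)
  have hm1 := h.mgf_le 1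
  have hm2 := h.mgf_le (-1)
  have hpt : ∀ y, ‖Y y‖ₑ ≤ ENNReal.ofReal (Real.exp (1 * Y y) + Real.exp (-1 * Y y)) := by
    intro y
    rw [← ofReal_norm, Real.norm_eq_abs]
    refine ENNReal.ofReal_le_ofReal (abs_le'.2 ⟨?_, ?_⟩)
    · linarith [Real.add_one_le_exp (1 * Y y), Real.exp_pos (-1 * Y y)]
    · linarith [Real.add_one_le_exp (-1 * Y y), Real.exp_pos (1 * Y y)]
  have h12 : Integrable (fun y => Real.exp (1 * Y y) + Real.exp (-1 * Y y)) μ := h1.add h2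
  refine (lintegral_mono hpt).trans ?_
  rw [← ofReal_integral_eq_lintegral_ofReal h12 (.of_forall fun y => by positivity)]
  refine ENNReal.ofReal_le_ofReal ?_
  rw [integral_add h1 h2]
  unfold mgf at hm1 hm2
  norm_num at hm1 hm2 ⊢
  linarith

/-! ### Expectations with values in `[-∞, ∞]` -/

section ExtExpectation

variable {Ω : Type*} [MeasurableSpace Ω] {P : Measure Ω} {Z H : Ω → ℝ}

theorem lintegral_ofReal_ne_top_of_le (hH : Integrable H P) (h : ∀ ω, Z ω ≤ H ω) :
    ∫⁻ ω, ENNReal.ofReal (Z ω) ∂P ≠ ⊤ := by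
  have hf : ∫⁻ ω, ENNReal.ofReal (H ω) ∂P < ⊤ :=
    (lintegral_mono fun ω => Real.ofReal_le_enorm (H ω)).trans_lt hH.2
  exact ((lintegral_mono fun ω => ENNReal.ofReal_le_ofReal (h ω)).trans_lt hf).ne

theorem extExpectation_le_integral (hZ : AEMeasurable Z P) (hH : Integrable H P)
    (h : ∀ ω, Z ω ≤ H ω) : extExpectation P Z ≤ ((∫ ω, H ω ∂P : ℝ) : EReal) := by
  have hpos := lintegral_ofReal_ne_top_of_le hH h
  unfold extExpectation
  -- If the negative part is not integrable, the expectation is `-∞`.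
  by_cases hneg : ∫⁻ ω, ENNReal.ofReal (-Z ω) ∂P = ⊤
  · rw [hneg, EReal.coe_ennreal_top, EReal.sub_top]
    exact bot_le
  · have hZi : Integrable Z P := by
      refine ⟨hZ.aestronglyMeasurable, ?_⟩
      have : ∀ ω, ‖Z ω‖ₑ ≤ ENNReal.ofReal (Z ω) + ENNReal.ofReal (-Z ω) := by
        intro ω
        rw [← ofReal_norm, Real.norm_eq_abs]
        rcases le_total 0 (Z ω) with h0 | h0
        · rw [abs_of_nonneg h0]
          exact le_self_add
        · rw [abs_of_nonpos h0]
          exact le_add_self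
      refine (lintegral_mono this).trans_lt ?_
      rw [lintegral_add_left' hZ.ennreal_ofReal]
      exact ENNReal.add_lt_top.2 ⟨hpos.lt_top, Ne.lt_top hneg⟩
    have hE := integral_eq_lintegral_pos_part_sub_lintegral_neg_part hZi
    have hle := integral_mono hZi hH h
    rw [← EReal.coe_ennreal_toReal hpos, ← EReal.coe_ennreal_toReal hneg, ← EReal.coe_sub, ← hE]
    exact_mod_cast hle

end ExtExpectation

/-! ### The true values and the value model -/

namespace ContextualBandit

variable {X A : Type*} [MeasurableSpace X] [MeasurableSpace A] {B : ContextualBandit X A}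

theorem measurable_fstar [IsMarkovKernel B.reward] :
    Measurable fun z : X × A => B.fstar z.1 z.2 :=
  (StronglyMeasurable.integral_kernel_prod_right' (κ := B.reward)
    (f := fun p : (X × A) × ℝ => p.2) measurable_snd.stronglyMeasurable).measurable

theorem RewardAssumption.bddAbove (hB : B.RewardAssumption) (x : X) :
    BddAbove (B.fstar x '' B.actions x) :=
  ⟨1, by rintro _ ⟨a, ha, rfl⟩; exact (hB x a ha).2.2⟩

theorem RewardAssumption.fstar_le_optValue (hB : B.RewardAssumption) {x : X} {a : A}
    (ha : a ∈ B.actions x) : B.fstar x a ≤ B.optValue x :=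
  le_csSup (hB.bddAbove x) ⟨a, ha, rfl⟩

theorem RewardAssumption.optValue_mem_Icc (hB : B.RewardAssumption) {x : X} {a : A}
    (ha : a ∈ B.actions x) : B.optValue x ∈ Set.Icc (0 : ℝ) 1 :=
  ⟨(hB x a ha).2.1.trans (hB.fstar_le_optValue ha),
    csSup_le ⟨_, a, ha, rfl⟩ (by rintro _ ⟨a', ha', rfl⟩; exact (hB x a' ha').2.2)⟩

end ContextualBandit

namespace ValueModel

variable {X A Θ : Type*} [MeasurableSpace X] [MeasurableSpace A] [MeasurableSpace Θ]
  {B : ContextualBandit X A} (M : ValueModel B Θ)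

theorem measurable_value : Measurable fun z : Θ × X => M.value z.1 z.2 :=
  M.measurable_f.comp (g := fun z : Θ × X × A => M.f z.1 z.2.1 z.2.2)
    (f := fun z : Θ × X => (z.1, z.2, M.greedy z.1 z.2))
    (measurable_fst.prodMk (measurable_snd.prodMk M.measurable_greedy))

theorem measurable_trunc (b : ℝ) : Measurable fun z : Θ × X × A => M.trunc b z.1 z.2.1 z.2.2 :=
  measurable_const.max (measurable_const.min M.measurable_f)

theorem measurable_truncValue (b : ℝ) : Measurable fun z : Θ × X => M.truncValue b z.1 z.2 :=
  measurable_const.max (measurable_const.min M.measurable_value)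

/-- The excess square loss `η [(f(θ,x,a) - r)² - (f_*(x,a) - r)²]`, which is the excess loss
without its Feel-Good term. -/
noncomputable def excessSq (η : ℝ) (θ : Θ) (z : X × A × ℝ) : ℝ :=
  η * ((M.f θ z.1 z.2.1 - z.2.2) ^ 2 - (B.fstar z.1 z.2.1 - z.2.2) ^ 2)

theorem measurable_excessSq [IsMarkovKernel B.reward] (η : ℝ) :
    Measurable fun p : Θ × (X × A × ℝ) => M.excessSq η p.1 p.2 := by
  have h1 : Measurable fun p : Θ × (X × A × ℝ) => M.f p.1 p.2.1 p.2.2.1 :=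
    M.measurable_f.comp (g := fun z : Θ × X × A => M.f z.1 z.2.1 z.2.2)
      (f := fun p : Θ × (X × A × ℝ) => (p.1, p.2.1, p.2.2.1)) (by fun_prop)
  have h2 : Measurable fun p : Θ × (X × A × ℝ) => B.fstar p.2.1 p.2.2.1 :=
    B.measurable_fstar.comp (g := fun z : X × A => B.fstar z.1 z.2)
      (f := fun p : Θ × (X × A × ℝ) => (p.2.1, p.2.2.1)) (by fun_prop)
  unfold excessSq
  fun_prop

theorem measurable_excessLoss [IsMarkovKernel B.reward] (hopt : Measurable B.optValue)
    (η lam b : ℝ) :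
    Measurable fun p : Θ × (X × A × ℝ) => M.excessLoss η lam b p.1 p.2 := by
  have h1 := M.measurable_excessSq η
  have h2 : Measurable fun p : Θ × (X × A × ℝ) => M.value p.1 p.2.1 :=
    M.measurable_value.comp (g := fun z : Θ × X => M.value z.1 z.2)
      (f := fun p : Θ × (X × A × ℝ) => (p.1, p.2.1)) (by fun_prop)
  have h3 : Measurable fun p : Θ × (X × A × ℝ) => B.optValue p.2.1 :=
    hopt.comp (measurable_fst.comp measurable_snd)
  unfold excessLoss
  unfold excessSq at h1
  fun_prop

theorem neg_excessSq_le {η : ℝ} (hη : 0 < η) (θ : Θ) (z : X × A × ℝ) :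
    -M.excessSq η θ z ≤ η * (B.fstar z.1 z.2.1 - z.2.2) ^ 2 := by
  unfold excessSq
  nlinarith [mul_nonneg hη.le (sq_nonneg (M.f θ z.1 z.2.1 - z.2.2))]

theorem neg_excessLoss_le {η lam b : ℝ} (hη : 0 < η) (hlam : 0 < lam) (θ : Θ) (z : X × A × ℝ) :
    -M.excessLoss η lam b θ z
      ≤ η * (B.fstar z.1 z.2.1 - z.2.2) ^ 2 + lam * (b - B.optValue z.1) := by
  have h1 := M.neg_excessSq_le hη θ z
  have h2 : lam * (min b (M.value θ z.1) - B.optValue z.1) ≤ lam * (b - B.optValue z.1) := by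
    gcongr
    exact min_le_left _ _
  unfold excessLoss
  unfold excessSq at h1
  linarith

/-- The loss and the excess loss differ by a quantity which does not depend on the parameter. -/
theorem loss_eq_excessLoss_add (η lam b : ℝ) (θ : Θ) (z : X × A × ℝ) :
    M.loss η lam b θ z = M.excessLoss η lam b θ z
      + (η * (B.fstar z.1 z.2.1 - z.2.2) ^ 2 - lam * B.optValue z.1) := by
  unfold loss excessLoss
  ring

/-! ### The posterior and the partition function -/

variable (p₀ : Measure Θ)

/-- The partition function `E_{θ ∼ p₀} exp(-∑_s ΔL(θ, x_s, a_s, r_s))` of a history. -/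
noncomputable def partition (η lam b : ℝ) (t : ℕ) (S : History X A t) : ℝ :=
  ∫ θ, Real.exp (-∑ s, M.excessLoss η lam b θ (S s)) ∂p₀

variable [IsProbabilityMeasure p₀]

/-- The posterior does not change when the loss is replaced by the excess loss. -/
theorem posterior_eq_tilted_excessLoss (η lam b : ℝ) (t : ℕ) (S : History X A t) :
    M.posterior p₀ η lam b t S
      = p₀.tilted fun θ => -∑ s, M.excessLoss η lam b θ (S s) := by
  change p₀.tilted (fun θ => -∑ s, M.loss η lam b θ (S s)) = _
  set k := ∑ s, (η * (B.fstar (S s).1 (S s).2.1 - (S s).2.2) ^ 2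
    - lam * B.optValue (S s).1) with hk
  have h : ∀ θ, Real.exp (-∑ s, M.loss η lam b θ (S s))
      = Real.exp (-∑ s, M.excessLoss η lam b θ (S s)) * Real.exp (-k) := by
    intro θ
    rw [← Real.exp_add]
    congr 1
    simp_rw [M.loss_eq_excessLoss_add]
    rw [Finset.sum_add_distrib]
    ring
  unfold Measure.tilted
  simp_rw [h, integral_mul_const]
  congr 1
  ext θ
  rw [mul_div_mul_right _ _ (Real.exp_pos _).ne']

variable {p₀} {η lam b : ℝ}

section Excess

variable [IsMarkovKernel B.reward] (hopt : Measurable B.optValue)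
include hopt

theorem measurable_exp_neg_sum_excessLoss (t : ℕ) :
    Measurable fun p : History X A t × Θ =>
      Real.exp (-∑ s, M.excessLoss η lam b p.2 (p.1 s)) := by
  refine Real.measurable_exp.comp (Measurable.neg ?_)
  refine Finset.measurable_fun_sum _ fun s _ => ?_
  exact (M.measurable_excessLoss hopt η lam b).comp
    (f := fun p : History X A t × Θ => (p.2, p.1 s)) (by fun_prop)

theorem measurable_partition (t : ℕ) : Measurable (M.partition p₀ η lam b t) :=
  ((M.measurable_exp_neg_sum_excessLoss hopt t).stronglyMeasurable.integral_prod_right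
    (ν := p₀)).measurable

theorem integrable_exp_neg_sum_excessLoss (hη : 0 < η) (hlam : 0 < lam) (t : ℕ)
    (S : History X A t) :
    Integrable (fun θ => Real.exp (-∑ s, M.excessLoss η lam b θ (S s))) p₀ := by
  refine Integrable.of_bound
    ((M.measurable_exp_neg_sum_excessLoss hopt t).comp
      measurable_prodMk_left).aestronglyMeasurable
    (Real.exp (∑ s, (η * (B.fstar (S s).1 (S s).2.1 - (S s).2.2) ^ 2
      + lam * (b - B.optValue (S s).1)))) (.of_forall fun θ => ?_)
  rw [Real.norm_eq_abs, Real.abs_exp, Real.exp_le_exp, ← Finset.sum_neg_distrib]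
  exact Finset.sum_le_sum fun s _ => M.neg_excessLoss_le hη hlam θ (S s)

theorem partition_pos (hη : 0 < η) (hlam : 0 < lam) (t : ℕ) (S : History X A t) :
    0 < M.partition p₀ η lam b t S :=
  integral_exp_pos (M.integrable_exp_neg_sum_excessLoss hopt hη hlam t S)

theorem isMarkovKernel_posterior (hη : 0 < η) (hlam : 0 < lam) (t : ℕ) :
    IsMarkovKernel (M.posterior p₀ η lam b t) :=
  ⟨fun S => by
    rw [M.posterior_eq_tilted_excessLoss]
    exact isProbabilityMeasure_tilted
      (M.integrable_exp_neg_sum_excessLoss hopt hη hlam t S)⟩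

/-- The partition function grows, from one round to the next, by the factor
`E exp(-ΔL)` under the posterior. -/
theorem partition_succ (hη : 0 < η) (hlam : 0 < lam) (t : ℕ) (S : History X A (t + 1)) :
    M.partition p₀ η lam b (t + 1) S
      = M.partition p₀ η lam b t (fun s => S s.castSucc)
        * ∫ θ, Real.exp (-M.excessLoss η lam b θ (S (Fin.last t)))
          ∂(M.posterior p₀ η lam b t fun s => S s.castSucc) := by
  have hpos := M.partition_pos (p₀ := p₀) (b := b) hopt hη hlam t fun s => S s.castSucc
  rw [M.posterior_eq_tilted_excessLoss, integral_tilted, ← integral_const_mul]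
  unfold partition at hpos ⊢
  congr 1
  ext θ
  rw [Fin.sum_univ_castSucc, neg_add, Real.exp_add, smul_eq_mul]
  field_simp

end Excess

/-- A bound on the logarithm of the increment of the partition function in one round. The second
term is the posterior mean of the Feel-Good term, the first one carries the square loss. -/
noncomputable def incrementBound (p₀ : Measure Θ) [IsProbabilityMeasure p₀] (η lam : ℝ) (t : ℕ)
    (S : History X A t) (z : X × A × ℝ) : ℝ :=
  (∫ θ, Real.exp (2 * -M.excessSq η θ z) ∂(M.posterior p₀ η lam 1 t S) - 1) / 2
    + lam * ∫ θ, (M.truncValue 1 θ z.1 - B.optValue z.1) ∂(M.posterior p₀ η lam 1 t S)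
    + 9 / 4 * lam ^ 2

section Bound

variable [IsMarkovKernel B.reward] (hopt : Measurable B.optValue)
include hopt

theorem integrable_exp_neg_excessLoss (hη : 0 < η) (hlam : 0 < lam) (ν : Measure Θ)
    [IsFiniteMeasure ν] (z : X × A × ℝ) :
    Integrable (fun θ => Real.exp (-M.excessLoss η lam b θ z)) ν := by
  have hm : Measurable fun θ => M.excessLoss η lam b θ z :=
    (M.measurable_excessLoss hopt η lam b).comp
      (f := fun θ : Θ => (θ, z)) measurable_prodMk_right
  refine Integrable.of_bound (by fun_prop)
    (Real.exp (η * (B.fstar z.1 z.2.1 - z.2.2) ^ 2 + lam * (b - B.optValue z.1)))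
    (.of_forall fun θ => ?_)
  rw [Real.norm_eq_abs, Real.abs_exp, Real.exp_le_exp]
  exact M.neg_excessLoss_le hη hlam θ z

theorem log_partition_succ_le (hB : B.RewardAssumption) (hη : 0 < η) (hlam : 0 < lam) (t : ℕ)
    (S : History X A (t + 1)) :
    Real.log (M.partition p₀ η lam 1 (t + 1) S)
      ≤ Real.log (M.partition p₀ η lam 1 t (fun s => S s.castSucc))
        + M.incrementBound p₀ η lam t (fun s => S s.castSucc) (S (Fin.last t)) := by
  have := M.isMarkovKernel_posterior (p₀ := p₀) (b := 1) hopt hη hlam t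
  set z := S (Fin.last t) with hz
  set ν := M.posterior p₀ η lam 1 t (fun s => S s.castSucc) with hν
  have hi := M.integrable_exp_neg_excessLoss (b := 1) hopt hη hlam ν z
  have hpos : 0 < ∫ θ, Real.exp (-M.excessLoss η lam 1 θ z) ∂ν := integral_exp_pos hi
  rw [M.partition_succ hopt hη hlam,
    Real.log_mul (M.partition_pos hopt hη hlam _ _).ne' hpos.ne']
  gcongr
  have hmU : Measurable fun θ => -M.excessSq η θ z :=
    ((M.measurable_excessSq η).comp measurable_prodMk_right).neg
  have hmV : Measurable fun θ => M.truncValue 1 θ z.1 - B.optValue z.1 :=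
    ((M.measurable_truncValue 1).comp measurable_prodMk_right).sub_const _
  have hVb : ∀ θ, M.truncValue 1 θ z.1 - B.optValue z.1 ∈ Set.Icc (-2 : ℝ) 1 := fun θ =>
    trunc_sub_mem_Icc (hB.optValue_mem_Icc (M.greedy_mem θ z.1))
  refine le_trans (Real.log_le_log hpos ?_) (log_integral_exp_add_le (ν := ν) hmU hmV
    (fun θ => M.neg_excessSq_le hη θ z) hVb lam)
  refine integral_mono hi ?_ fun θ => ?_
  · refine Integrable.of_bound (by fun_prop)
      (Real.exp (η * (B.fstar z.1 z.2.1 - z.2.2) ^ 2 + lam)) (.of_forall fun θ => ?_)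
    rw [Real.norm_eq_abs, Real.abs_exp, Real.exp_le_exp]
    have h1 := M.neg_excessSq_le hη θ z
    nlinarith [(hVb θ).2]
  · rw [Real.exp_le_exp]
    -- Truncation from below can only increase the Feel-Good term.
    have h1 : min 1 (M.value θ z.1) ≤ M.truncValue 1 θ z.1 := le_max_right _ _
    have h2 : lam * (min 1 (M.value θ z.1) - B.optValue z.1)
        ≤ lam * (M.truncValue 1 θ z.1 - B.optValue z.1) := by gcongr
    unfold excessLoss excessSq
    linarith

theorem measurable_integral_posterior {E : Type*} [MeasurableSpace E] (hη : 0 < η)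
    (hlam : 0 < lam) {t : ℕ} {S : E → History X A t} (hS : Measurable S) {G : E × Θ → ℝ}
    (hG : Measurable G) :
    Measurable fun e => ∫ θ', G (e, θ') ∂(M.posterior p₀ η lam b t (S e)) := by
  have := M.isMarkovKernel_posterior (p₀ := p₀) (b := b) hopt hη hlam t
  exact (hG.stronglyMeasurable.integral_kernel_prod_right'
    (κ := (M.posterior p₀ η lam b t).comap S hS)).measurable

end Bound

/-! ### Averaging over the posterior and the reward -/

section RewardAverage

variable [IsMarkovKernel B.reward]

theorem measurable_sq_trunc_sub_fstar (b : ℝ) :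
    Measurable fun p : Θ × (X × A) =>
      (M.trunc b p.1 p.2.1 p.2.2 - B.fstar p.2.1 p.2.2) ^ 2 :=
  ((M.measurable_trunc b).sub (B.measurable_fstar.comp measurable_snd)).pow_const 2

omit [IsMarkovKernel B.reward] in
theorem sq_trunc_sub_fstar_mem_Icc (hB : B.RewardAssumption) {y : X} {a : A}
    (ha : a ∈ B.actions y) (θ : Θ) :
    (M.trunc 1 θ y a - B.fstar y a) ^ 2 ∈ Set.Icc (0 : ℝ) 4 :=
  ⟨sq_nonneg _, sq_trunc_sub_le_four (hB y a ha).2⟩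

theorem integrable_sq_trunc_sub_fstar (hB : B.RewardAssumption) {y : X} {a : A}
    (ha : a ∈ B.actions y) (ν : Measure Θ) [IsFiniteMeasure ν] :
    Integrable (fun θ => (M.trunc 1 θ y a - B.fstar y a) ^ 2) ν :=
  Integrable.of_mem_Icc 0 4 ((M.measurable_sq_trunc_sub_fstar 1).comp
    (f := fun θ : Θ => (θ, (y, a))) measurable_prodMk_right).aemeasurable
    (.of_forall fun θ => M.sq_trunc_sub_fstar_mem_Icc hB ha θ)

theorem integral_sq_trunc_sub_fstar_mem_Icc (hB : B.RewardAssumption) {y : X} {a : A}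
    (ha : a ∈ B.actions y) (ν : Measure Θ) [IsProbabilityMeasure ν] :
    ∫ θ, (M.trunc 1 θ y a - B.fstar y a) ^ 2 ∂ν ∈ Set.Icc (0 : ℝ) 4 :=
  ⟨integral_nonneg fun θ => sq_nonneg _, by
    simpa using integral_mono (M.integrable_sq_trunc_sub_fstar hB ha ν)
      (integrable_const (4 : ℝ)) fun θ => (M.sq_trunc_sub_fstar_mem_Icc hB ha θ).2⟩

theorem measurable_exp_excessSq :
    Measurable fun p : Θ × (X × A × ℝ) => Real.exp (2 * -M.excessSq η p.1 p.2) :=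
  Real.measurable_exp.comp ((M.measurable_excessSq η).neg.const_mul 2)

theorem integrable_exp_excessSq (hη : 0 < η) (ν : Measure Θ) [IsFiniteMeasure ν]
    (z : X × A × ℝ) : Integrable (fun θ => Real.exp (2 * -M.excessSq η θ z)) ν := by
  refine Integrable.of_bound (M.measurable_exp_excessSq.comp
    (f := fun θ : Θ => (θ, z)) measurable_prodMk_right).aestronglyMeasurable
    (Real.exp (2 * (η * (B.fstar z.1 z.2.1 - z.2.2) ^ 2))) (.of_forall fun θ => ?_)
  rw [Real.norm_eq_abs, Real.abs_exp, Real.exp_le_exp]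
  have := M.neg_excessSq_le hη θ z
  gcongr

/-- Averaging over the reward first, the exponential moment of the excess square loss is
controlled by the mean squared error at the given action. -/
theorem lintegral_reward_exp_excessSq_le (hB : B.RewardAssumption) (hη : 0 < η)
    (hη' : η ≤ 1 / 4) {y : X} {a : A} (ha : a ∈ B.actions y) (ν : Measure Θ)
    [IsProbabilityMeasure ν] :
    ∫⁻ ρ, ENNReal.ofReal (∫ θ, Real.exp (2 * -M.excessSq η θ (y, a, ρ)) ∂ν) ∂(B.reward (y, a))
      ≤ ENNReal.ofReal (1 - η / 2 * ∫ θ, (M.trunc 1 θ y a - B.fstar y a) ^ 2 ∂ν) := by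
  have hm : Measurable fun p : ℝ × Θ =>
      ENNReal.ofReal (Real.exp (2 * -M.excessSq η p.2 (y, a, p.1))) :=
    (M.measurable_exp_excessSq.comp (f := fun p : ℝ × Θ => (p.2, (y, a, p.1)))
      (by fun_prop)).ennreal_ofReal
  have hpt : ∀ θ, ∫⁻ ρ, ENNReal.ofReal (Real.exp (2 * -M.excessSq η θ (y, a, ρ)))
      ∂(B.reward (y, a)) ≤ ENNReal.ofReal (1 - η / 2 * (M.trunc 1 θ y a - B.fstar y a) ^ 2) :=
    fun θ => by
      unfold excessSq trunc
      exact lintegral_exp_excess_sq_le (hB y a ha).1 (hB y a ha).2 hη hη' (M.f θ y a)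
  have hle : ∀ θ, η / 2 * (M.trunc 1 θ y a - B.fstar y a) ^ 2 ≤ 1 := fun θ => by
    obtain ⟨h0, h4⟩ := M.sq_trunc_sub_fstar_mem_Icc hB ha θ
    nlinarith
  calc _ = ∫⁻ ρ, ∫⁻ θ, ENNReal.ofReal (Real.exp (2 * -M.excessSq η θ (y, a, ρ))) ∂ν
            ∂(B.reward (y, a)) :=
        lintegral_congr fun ρ => ofReal_integral_eq_lintegral_ofReal
          (M.integrable_exp_excessSq hη ν _) (.of_forall fun θ => (Real.exp_pos _).le)
    _ = ∫⁻ θ, ∫⁻ ρ, ENNReal.ofReal (Real.exp (2 * -M.excessSq η θ (y, a, ρ)))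
            ∂(B.reward (y, a)) ∂ν := lintegral_lintegral_swap hm.aemeasurable
    _ ≤ ∫⁻ θ, ENNReal.ofReal (1 - η / 2 * (M.trunc 1 θ y a - B.fstar y a) ^ 2) ∂ν :=
        lintegral_mono hpt
    _ = _ := lintegral_ofReal_one_sub_mul (M.integrable_sq_trunc_sub_fstar hB ha ν) hle

end RewardAverage

end ValueModel

/-! ### One round of Feel-Good Thompson Sampling -/

namespace IsFeelGoodTS

variable {X A Θ Ω : Type*} [MeasurableSpace X] [MeasurableSpace A] [MeasurableSpace Θ]
  [MeasurableSpace Ω] {B : ContextualBandit X A} {M : ValueModel B Θ}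
  {p₀ : Measure Θ} [IsProbabilityMeasure p₀] {η lam : ℝ} {T : ℕ} {P : Measure Ω}
  {x : ℕ → Ω → X} {θ : ℕ → Ω → Θ} {r : ℕ → Ω → ℝ}

section Measurability

variable {b : ℝ} (hrun : IsFeelGoodTS M p₀ η lam b T P x θ r)
include hrun

theorem measurable_action {t : ℕ} (ht : t < T) :
    Measurable fun ω => M.greedy (θ t ω) (x t ω) :=
  M.measurable_greedy.comp ((hrun.measurable_θ t ht).prodMk (hrun.measurable_x t ht))

theorem measurable_history {t : ℕ} (ht : t ≤ T) : Measurable (history M x θ r t) :=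
  measurable_pi_lambda _ fun s =>
    (hrun.measurable_x s (s.2.trans_le ht)).prodMk
      ((hrun.measurable_action (s.2.trans_le ht)).prodMk (hrun.measurable_r s (s.2.trans_le ht)))

theorem measurable_contextAction {t : ℕ} (ht : t < T) :
    Measurable fun ω => (x t ω, M.greedy (θ t ω) (x t ω)) :=
  (hrun.measurable_x t ht).prodMk (hrun.measurable_action ht)

end Measurability

variable [IsProbabilityMeasure P] [IsMarkovKernel B.reward]
  (hrun : IsFeelGoodTS M p₀ η lam 1 T P x θ r)
include hrun

/-- The noise of a round is orthogonal to every bounded function of the context and the action. -/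
theorem integrable_mul_noise_and_integral_eq_zero (hB : B.RewardAssumption) {ψ : X × A → ℝ}
    (hψ : Measurable ψ) {C : ℝ} (hC : ∀ y, ∀ a ∈ B.actions y, |ψ (y, a)| ≤ C) {t : ℕ} (ht : t < T) :
    Integrable (fun ω => ψ (x t ω, M.greedy (θ t ω) (x t ω))
        * (r t ω - B.fstar (x t ω) (M.greedy (θ t ω) (x t ω)))) P ∧
      ∫ ω, ψ (x t ω, M.greedy (θ t ω) (x t ω))
        * (r t ω - B.fstar (x t ω) (M.greedy (θ t ω) (x t ω))) ∂P = 0 := by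
  have hlaw := hrun.reward_law t ht
  set G : (History X A t × (X × A)) × ℝ → ℝ :=
    fun p => ψ p.1.2 * (p.2 - B.fstar p.1.2.1 p.1.2.2) with hG
  have hGm : Measurable G := by
    have h1 : Measurable fun p : (History X A t × (X × A)) × ℝ => ψ p.1.2 :=
      hψ.comp (by fun_prop)
    have h2 : Measurable fun p : (History X A t × (X × A)) × ℝ => B.fstar p.1.2.1 p.1.2.2 :=
      B.measurable_fstar.comp (f := fun p : (History X A t × (X × A)) × ℝ => p.1.2) (by fun_prop)
    exact h1.mul (measurable_snd.sub h2)
  have hmem : ∀ ω, M.greedy (θ t ω) (x t ω) ∈ B.actions (x t ω) := fun ω => M.greedy_mem _ _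
  have hi : Integrable (fun ω => G
      ((history M x θ r t ω, (x t ω, M.greedy (θ t ω) (x t ω))), r t ω)) P := by
    refine ⟨(hGm.comp (((hrun.measurable_history ht.le).prodMk
      (hrun.measurable_contextAction ht)).prodMk (hrun.measurable_r t ht))).aestronglyMeasurable,
      ?_⟩
    rw [hasFiniteIntegral_iff_enorm]
    rw [HasCondDistrib.lintegral_comp_prodMk hlaw hGm.enorm]
    calc _ ≤ ∫⁻ _, ENNReal.ofReal C
            * ENNReal.ofReal (2 * Real.exp (((1 / 4 : ℝ≥0) : ℝ) / 2)) ∂P := by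
          refine lintegral_mono fun ω => ?_
          simp only [hG, enorm_mul, Kernel.prodMkLeft_apply]
          have hsub := (hB _ _ (hmem ω)).1
          rw [lintegral_const_mul' _ _ enorm_ne_top]
          gcongr
          · rw [← ofReal_norm, Real.norm_eq_abs]
            exact ENNReal.ofReal_le_ofReal (hC _ _ (hmem ω))
          · exact lintegral_enorm_le_of_hasSubgaussianMGF hsub
      _ < ⊤ := by
          rw [lintegral_const, measure_univ, mul_one]
          exact ENNReal.mul_lt_top ENNReal.ofReal_lt_top ENNReal.ofReal_lt_top
  refine ⟨hi, ?_⟩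
  have h0 := HasCondDistrib.integral_comp_prodMk hlaw hGm hi
  simp only [hG] at h0
  rw [h0]
  refine integral_eq_zero_of_ae (.of_forall fun ω => ?_)
  simp only [Kernel.prodMkLeft_apply, Pi.zero_apply]
  have hr : Integrable (fun y : ℝ => y)
      (B.reward (x t ω, M.greedy (θ t ω) (x t ω))) := by
    refine ((hB _ _ (hmem ω)).1.integrable.add
      (integrable_const (B.fstar (x t ω) (M.greedy (θ t ω) (x t ω))))).congr
      (.of_forall fun y => ?_)
    simp
  rw [integral_const_mul, integral_sub hr (integrable_const _)]
  simp [ContextualBandit.fstar]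

variable (hopt : Measurable B.optValue) (hB : B.RewardAssumption) (hη : 0 < η) (hlam : 0 < lam)
include hopt hB hη hlam

theorem expFG_eq_integral_posterior {t : ℕ} (ht : t < T) :
    expFG M P x θ 1 t = ∫ ω, ∫ θ', (M.truncValue 1 θ' (x t ω) - B.optValue (x t ω))
      ∂(M.posterior p₀ η lam 1 t (history M x θ r t ω)) ∂P := by
  have := M.isMarkovKernel_posterior (p₀ := p₀) (b := 1) hopt hη hlam t
  set G : (History X A t × X) × Θ → ℝ :=
    fun p => M.truncValue 1 p.2 p.1.2 - B.optValue p.1.2 with hG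
  have hGm : Measurable G :=
    ((M.measurable_truncValue 1).comp
      (f := fun p : (History X A t × X) × Θ => (p.2, p.1.2)) (by fun_prop)).sub
      (hopt.comp (by fun_prop))
  have hi : Integrable (fun ω => G ((history M x θ r t ω, x t ω), θ t ω)) P := by
    refine Integrable.of_mem_Icc (-2) 1 (hGm.comp (((hrun.measurable_history ht.le).prodMk
      (hrun.measurable_x t ht)).prodMk (hrun.measurable_θ t ht))).aemeasurable
      (.of_forall fun ω => ?_)
    exact trunc_sub_mem_Icc (hB.optValue_mem_Icc (M.greedy_mem (θ t ω) _))
  exact HasCondDistrib.integral_comp_prodMk (hrun.param_law t ht) hGm hi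

/-- The expected exponential moment of the excess square loss is controlled by the expected
least-squares error: integrate first over the reward, given the history, the context and the
action. -/
theorem integrable_and_integral_exp_excessSq_le (hη' : η ≤ 1 / 4) {t : ℕ} (ht : t < T) :
    Integrable (fun ω => ∫ θ', Real.exp (2 * -M.excessSq η θ'
        (x t ω, M.greedy (θ t ω) (x t ω), r t ω))
        ∂(M.posterior p₀ η lam 1 t (history M x θ r t ω))) P ∧
      ∫ ω, ∫ θ', Real.exp (2 * -M.excessSq η θ' (x t ω, M.greedy (θ t ω) (x t ω), r t ω))
        ∂(M.posterior p₀ η lam 1 t (history M x θ r t ω)) ∂P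
      ≤ 1 - η / 2 * expLS M P x θ r p₀ η lam 1 t := by
  have := M.isMarkovKernel_posterior (p₀ := p₀) (b := 1) hopt hη hlam t
  have hmem : ∀ ω, M.greedy (θ t ω) (x t ω) ∈ B.actions (x t ω) := fun ω => M.greedy_mem _ _
  have hS := hrun.measurable_history ht.le
  have hxa := hrun.measurable_contextAction ht
  have hDm : Measurable fun ω => ∫ θ', (M.trunc 1 θ' (x t ω) (M.greedy (θ t ω) (x t ω))
      - B.fstar (x t ω) (M.greedy (θ t ω) (x t ω))) ^ 2
      ∂(M.posterior p₀ η lam 1 t (history M x θ r t ω)) :=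
    M.measurable_integral_posterior hopt hη hlam hS
      ((M.measurable_sq_trunc_sub_fstar 1).comp
        (f := fun p : Ω × Θ => (p.2, (x t p.1, M.greedy (θ t p.1) (x t p.1))))
        (measurable_snd.prodMk (hxa.comp measurable_fst)))
  have hD4 := fun ω => M.integral_sq_trunc_sub_fstar_mem_Icc hB (hmem ω)
    (M.posterior p₀ η lam 1 t (history M x θ r t ω))
  have hDi := Integrable.of_mem_Icc (μ := P) 0 4 hDm.aemeasurable (.of_forall hD4)
  have hAm : Measurable fun p : (History X A t × (X × A)) × ℝ =>
      ∫ θ', Real.exp (2 * -M.excessSq η θ' (p.1.2.1, p.1.2.2, p.2))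
        ∂(M.posterior p₀ η lam 1 t p.1.1) :=
    M.measurable_integral_posterior hopt hη hlam
      (S := fun p : (History X A t × (X × A)) × ℝ => p.1.1) (by fun_prop)
      (M.measurable_exp_excessSq.comp
        (f := fun q : ((History X A t × (X × A)) × ℝ) × Θ =>
          (q.2, (q.1.1.2.1, q.1.1.2.2, q.1.2))) (by fun_prop))
  have hAmω := hAm.comp ((hS.prodMk hxa).prodMk (hrun.measurable_r t ht))
  have hA0 : ∀ ω, 0 ≤ ∫ θ', Real.exp (2 * -M.excessSq η θ'
      (x t ω, M.greedy (θ t ω) (x t ω), r t ω))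
      ∂(M.posterior p₀ η lam 1 t (history M x θ r t ω)) := fun ω =>
    integral_nonneg fun θ' => (Real.exp_pos _).le
  have key : ∫⁻ ω, ENNReal.ofReal (∫ θ', Real.exp (2 * -M.excessSq η θ'
      (x t ω, M.greedy (θ t ω) (x t ω), r t ω))
      ∂(M.posterior p₀ η lam 1 t (history M x θ r t ω))) ∂P
      ≤ ENNReal.ofReal (1 - η / 2 * expLS M P x θ r p₀ η lam 1 t) := by
    refine (HasCondDistrib.lintegral_comp_prodMk (hrun.reward_law t ht)
      hAm.ennreal_ofReal).trans_le ?_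
    refine (lintegral_mono fun ω => M.lintegral_reward_exp_excessSq_le hB hη hη' (hmem ω)
      (M.posterior p₀ η lam 1 t (history M x θ r t ω))).trans_eq ?_
    refine lintegral_ofReal_one_sub_mul hDi fun ω => ?_
    have h4 := (hD4 ω).2
    have h0 := (hD4 ω).1
    nlinarith
  have hi : Integrable (fun ω => ∫ θ', Real.exp (2 * -M.excessSq η θ'
      (x t ω, M.greedy (θ t ω) (x t ω), r t ω))
      ∂(M.posterior p₀ η lam 1 t (history M x θ r t ω))) P := by
    refine ⟨hAmω.aestronglyMeasurable, ?_⟩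
    rw [hasFiniteIntegral_iff_ofReal (.of_forall hA0)]
    exact key.trans_lt ENNReal.ofReal_lt_top
  refine ⟨hi, ?_⟩
  rw [← ofReal_integral_eq_lintegral_ofReal hi (.of_forall hA0)] at key
  refine (ENNReal.ofReal_le_ofReal_iff ?_).1 key
  have hle : expLS M P x θ r p₀ η lam 1 t ≤ 4 :=
    (integral_mono hDi (integrable_const (4 : ℝ)) fun ω => (hD4 ω).2).trans (by simp)
  nlinarith

/-- The increment bound of a round has expectation at most `-η/4 E LS_t + λ E FG_t + 9/4 λ²`. -/
theorem integrable_and_integral_incrementBound_le (hη' : η ≤ 1 / 4) {t : ℕ} (ht : t < T) :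
    Integrable (fun ω => M.incrementBound p₀ η lam t (history M x θ r t ω)
        (x t ω, M.greedy (θ t ω) (x t ω), r t ω)) P ∧
      ∫ ω, M.incrementBound p₀ η lam t (history M x θ r t ω)
        (x t ω, M.greedy (θ t ω) (x t ω), r t ω) ∂P
      ≤ -(η / 4 * expLS M P x θ r p₀ η lam 1 t) + lam * expFG M P x θ 1 t + 9 / 4 * lam ^ 2 := by
  have := M.isMarkovKernel_posterior (p₀ := p₀) (b := 1) hopt hη hlam t
  obtain ⟨hAi, hA⟩ := hrun.integrable_and_integral_exp_excessSq_le hopt hB hη hlam hη' ht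
  have hVm : Measurable fun p : Ω × Θ => M.truncValue 1 p.2 (x t p.1) - B.optValue (x t p.1) :=
    ((M.measurable_truncValue 1).comp (f := fun p : Ω × Θ => (p.2, x t p.1))
      (measurable_snd.prodMk ((hrun.measurable_x t ht).comp measurable_fst))).sub
      (hopt.comp ((hrun.measurable_x t ht).comp measurable_fst))
  have hVi : Integrable (fun ω => ∫ θ', (M.truncValue 1 θ' (x t ω) - B.optValue (x t ω))
      ∂(M.posterior p₀ η lam 1 t (history M x θ r t ω))) P := by
    refine Integrable.of_bound (M.measurable_integral_posterior hopt hη hlam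
      (hrun.measurable_history ht.le) hVm).aestronglyMeasurable 2 (.of_forall fun ω => ?_)
    refine (norm_integral_le_of_norm_le_const (C := 2) (.of_forall fun θ' => ?_)).trans ?_
    · obtain ⟨h1, h2⟩ := trunc_sub_mem_Icc (y := M.value θ' (x t ω))
        (hB.optValue_mem_Icc (M.greedy_mem (θ t ω) (x t ω)))
      exact abs_le.2 ⟨h1, h2.trans (by norm_num)⟩
    · simp
  have h1 : Integrable (fun ω => (∫ θ', Real.exp (2 * -M.excessSq η θ'
      (x t ω, M.greedy (θ t ω) (x t ω), r t ω))
      ∂(M.posterior p₀ η lam 1 t (history M x θ r t ω)) - 1) / 2) P :=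
    (hAi.sub (integrable_const _)).div_const 2
  have h2 := hVi.const_mul lam
  unfold ValueModel.incrementBound
  refine ⟨(h1.add h2).add (integrable_const _), ?_⟩
  rw [integral_add (by exact h1.add h2) (integrable_const _), integral_add h1 h2, integral_div,
    integral_sub hAi (integrable_const _), integral_const_mul,
    ← hrun.expFG_eq_integral_posterior hopt hB hη hlam ht]
  simp only [integral_const, probReal_univ, smul_eq_mul, mul_one, one_mul]
  linarith

/-- Decoupling in one round: the prediction error at the played action is compared with the
error of a fresh posterior draw. -/
theorem expReg_le [MeasurableSingletonClass A] {K : ℕ}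
    (hK : ∀ y, (B.actions y).encard ≤ K) {t : ℕ} (ht : t < T) :
    expReg M P x θ t ≤ lam * K / η + 1 / 4 * η / lam * expLS M P x θ r p₀ η lam 1 t
      - expFG M P x θ 1 t := by
  have := M.isMarkovKernel_posterior (p₀ := p₀) (b := 1) hopt hη hlam t
  have hS := hrun.measurable_history ht.le
  have hx := hrun.measurable_x t ht
  set h : X → Θ → A → ℝ := fun y θ' a => M.trunc 1 θ' y a - B.fstar y a with hh
  have hhm : Measurable fun p : X × Θ × A => h p.1 p.2.1 p.2.2 :=
    ((M.measurable_trunc 1).comp (f := fun p : X × Θ × A => (p.2.1, p.1, p.2.2))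
      (by fun_prop)).sub
      (B.measurable_fstar.comp (f := fun p : X × Θ × A => (p.1, p.2.2)) (by fun_prop))
  have hhb : ∀ y θ', ∀ a ∈ B.actions y, h y θ' a ∈ Set.Icc (-2 : ℝ) 1 := fun y θ' a ha =>
    trunc_sub_mem_Icc (hB y a ha).2
  have hhq : ∀ y θ', ∀ a ∈ B.actions y, h y θ' a ^ 2 ∈ Set.Icc (0 : ℝ) 4 := fun y θ' a ha =>
    ⟨sq_nonneg _, sq_trunc_sub_le_four (hB y a ha).2⟩
  -- the squared error of a fresh draw `θ'` at the action chosen by `θ`, averaged over `θ'`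
  set Q : History X A t × X → A → ℝ := fun e a =>
    ∫ θ', h e.2 θ' a ^ 2 ∂(M.posterior p₀ η lam 1 t e.1) with hQ
  have hQm : Measurable fun p : (History X A t × X) × Θ => Q p.1 (M.greedy p.2 p.1.2) := by
    have hg : Measurable fun p : (History X A t × X) × Θ => M.greedy p.2 p.1.2 :=
      M.measurable_greedy.comp (f := fun p : (History X A t × X) × Θ => (p.2, p.1.2))
        (by fun_prop)
    refine M.measurable_integral_posterior hopt hη hlam
      (S := fun p : (History X A t × X) × Θ => p.1.1) (by fun_prop)
      (G := fun q => h q.1.1.2 q.2 (M.greedy q.1.2 q.1.1.2) ^ 2) ?_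
    exact (hhm.comp (f := fun q : ((History X A t × X) × Θ) × Θ =>
      (q.1.1.2, q.2, M.greedy q.1.2 q.1.1.2))
      ((by fun_prop : Measurable fun q : ((History X A t × X) × Θ) × Θ => q.1.1.2).prodMk
        (measurable_snd.prodMk (hg.comp measurable_fst)))).pow_const 2
  have hQb : ∀ e, ∀ a ∈ B.actions e.2, Q e a ∈ Set.Icc (0 : ℝ) 4 := fun e a ha => by
    refine ⟨integral_nonneg fun θ' => sq_nonneg _, ?_⟩
    have hmeas : Measurable fun θ' => h e.2 θ' a ^ 2 :=
      (hhm.comp (f := fun θ' : Θ => (e.2, θ', a)) (by fun_prop)).pow_const 2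
    have hi : Integrable (fun θ' => h e.2 θ' a ^ 2) (M.posterior p₀ η lam 1 t e.1) :=
      Integrable.of_mem_Icc 0 4 hmeas.aemeasurable (.of_forall fun θ' => hhq _ θ' a ha)
    simpa using integral_mono hi (integrable_const (4 : ℝ)) fun θ' => (hhq _ θ' a ha).2
  have hjoint : Measurable fun ω => ((history M x θ r t ω, x t ω), θ t ω) :=
    (hS.prodMk hx).prodMk (hrun.measurable_θ t ht)
  have hHm : Measurable fun p : (History X A t × X) × Θ => h p.1.2 p.2 (M.greedy p.2 p.1.2) :=
    hhm.comp (f := fun p : (History X A t × X) × Θ => (p.1.2, p.2, M.greedy p.2 p.1.2))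
      ((by fun_prop : Measurable fun p : (History X A t × X) × Θ => p.1.2).prodMk
        (measurable_snd.prodMk (M.measurable_greedy.comp
          (f := fun p : (History X A t × X) × Θ => (p.2, p.1.2)) (by fun_prop))))
  have hHi : Integrable (fun ω => h (x t ω) (θ t ω) (M.greedy (θ t ω) (x t ω))) P :=
    Integrable.of_mem_Icc (-2) 1 (hHm.comp hjoint).aemeasurable
      (.of_forall fun ω => hhb _ _ _ (M.greedy_mem _ _))
  have hQi : Integrable (fun ω => Q (history M x θ r t ω, x t ω)
      (M.greedy (θ t ω) (x t ω))) P :=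
    Integrable.of_mem_Icc 0 4 (hQm.comp hjoint).aemeasurable
      (.of_forall fun ω => hQb (history M x θ r t ω, x t ω) _ (M.greedy_mem _ _))
  have hlaw := hrun.param_law t ht
  have hH := HasCondDistrib.integral_comp_prodMk hlaw hHm hHi
  have hLS := HasCondDistrib.integral_comp_prodMk hlaw hQm hQi
  simp only [Kernel.prodMkRight_apply] at hH hLS
  have hFGi : Integrable (fun ω => M.truncValue 1 (θ t ω) (x t ω) - B.optValue (x t ω)) P := by
    refine Integrable.of_mem_Icc (-2) 1 ?_ (.of_forall fun ω =>
      trunc_sub_mem_Icc (hB.optValue_mem_Icc (M.greedy_mem (θ t ω) (x t ω))))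
    exact (((M.measurable_truncValue 1).comp
      ((hrun.measurable_θ t ht).prodMk hx)).sub (hopt.comp hx)).aemeasurable
  have hsplit : expReg M P x θ t
      = ∫ ω, h (x t ω) (θ t ω) (M.greedy (θ t ω) (x t ω)) ∂P - expFG M P x θ 1 t := by
    unfold expReg expFG
    rw [← integral_sub hHi hFGi]
    congr 1
    ext ω
    simp only [hh, ValueModel.truncValue]
    ring
  have hLS' : expLS M P x θ r p₀ η lam 1 t
      = ∫ ω, Q (history M x θ r t ω, x t ω) (M.greedy (θ t ω) (x t ω)) ∂P := rfl
  have hc : 0 < 1 / 4 * η / lam := by positivity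
  have hq1 : Integrable (fun ω => ∫ θ', h (x t ω) θ' (M.greedy θ' (x t ω))
      ∂(M.posterior p₀ η lam 1 t (history M x θ r t ω))) P := by
    refine Integrable.of_bound (M.measurable_integral_posterior hopt hη hlam hS
      (G := fun p : Ω × Θ => h (x t p.1) p.2 (M.greedy p.2 (x t p.1)))
      ?_).aestronglyMeasurable 2 (.of_forall fun ω => ?_)
    · exact hHm.comp (f := fun p : Ω × Θ => ((history M x θ r t p.1, x t p.1), p.2))
        (((hS.comp measurable_fst).prodMk (hx.comp measurable_fst)).prodMk measurable_snd)
    · refine (norm_integral_le_of_norm_le_const (C := 2) (.of_forall fun θ' => ?_)).trans ?_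
      · obtain ⟨h1, h2⟩ := hhb (x t ω) θ' _ (M.greedy_mem θ' _)
        exact abs_le.2 ⟨h1, h2.trans (by norm_num)⟩
      · simp
  have hq2 : Integrable (fun ω => ∫ θ', Q (history M x θ r t ω, x t ω) (M.greedy θ' (x t ω))
      ∂(M.posterior p₀ η lam 1 t (history M x θ r t ω))) P := by
    refine Integrable.of_bound (M.measurable_integral_posterior hopt hη hlam hS
      (G := fun p : Ω × Θ => Q (history M x θ r t p.1, x t p.1) (M.greedy p.2 (x t p.1)))
      ?_).aestronglyMeasurable 4 (.of_forall fun ω => ?_)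
    · exact hQm.comp (f := fun p : Ω × Θ => ((history M x θ r t p.1, x t p.1), p.2))
        (((hS.comp measurable_fst).prodMk (hx.comp measurable_fst)).prodMk measurable_snd)
    · refine (norm_integral_le_of_norm_le_const (C := 4) (.of_forall fun θ' => ?_)).trans ?_
      · obtain ⟨h1, h2⟩ := hQb (history M x θ r t ω, x t ω) _ (M.greedy_mem θ' _)
        exact abs_le.2 ⟨by linarith, h2⟩
      · simp
  have hdec : ∀ ω, ∫ θ', h (x t ω) θ' (M.greedy θ' (x t ω))
        ∂(M.posterior p₀ η lam 1 t (history M x θ r t ω))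
      ≤ lam * K / η + 1 / 4 * η / lam *
        ∫ θ', Q (history M x θ r t ω, x t ω) (M.greedy θ' (x t ω))
          ∂(M.posterior p₀ η lam 1 t (history M x θ r t ω)) := by
    intro ω
    -- The constant `c = η / (4λ)` turns `K / (4c)` into `λK / η`.
    have hfin : (B.actions (x t ω)).Finite :=
      Set.finite_of_encard_le_coe (hK (x t ω))
    have hmeas : ∀ a, Measurable fun θ' => h (x t ω) θ' a := fun a =>
      hhm.comp (f := fun θ' : Θ => (x t ω, θ', a)) (by fun_prop)
    have hcard : (hfin.toFinset.card : ℝ) ≤ K := by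
      have := hK (x t ω)
      rw [hfin.encard_eq_coe_toFinset_card] at this
      exact_mod_cast this
    refine (integral_le_card_add_decoupled_sq (s := hfin.toFinset) (c := 1 / 4 * η / lam)
      (q := fun θ' => M.greedy θ' (x t ω)) (h := h (x t ω))
      (M.measurable_greedy.comp measurable_prodMk_right)
      (fun θ' => by simpa using M.greedy_mem θ' (x t ω))
      (fun a ha => Integrable.of_mem_Icc (-2) 1 (hmeas a).aemeasurable
        (.of_forall fun θ' => hhb _ θ' a (by simpa using ha)))
      (fun a ha => Integrable.of_mem_Icc 0 4 ((hmeas a).pow_const 2).aemeasurable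
        (.of_forall fun θ' => hhq _ θ' a (by simpa using ha))) hc).trans ?_
    have he : lam * K / η = K / (4 * (1 / 4 * η / lam)) := by
      field_simp
    rw [he]
    gcongr
  rw [hsplit, hH, hLS', hLS]
  gcongr
  exact (integral_mono hq1 ((integrable_const _).add (hq2.const_mul _)) hdec).trans_eq
    (integral_const_add_mul hq2 _ _)

end IsFeelGoodTS

/-! ### The regret bound over all rounds -/

/-- The logarithm of the partition function telescopes over the rounds. -/
theorem ValueModel.logPartition_le_sum_incrementBound
    {X A Θ Ω : Type*} [MeasurableSpace X] [MeasurableSpace A] [MeasurableSpace Θ]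
    {B : ContextualBandit X A} (M : ValueModel B Θ)
    {p₀ : Measure Θ} [IsProbabilityMeasure p₀] {η lam : ℝ}
    {x : ℕ → Ω → X} {θ : ℕ → Ω → Θ} {r : ℕ → Ω → ℝ} [IsMarkovKernel B.reward]
    (hopt : Measurable B.optValue) (hB : B.RewardAssumption) (hη : 0 < η) (hlam : 0 < lam)
    (T : ℕ) (ω : Ω) :
    logPartition M x θ r p₀ η lam 1 T ω
      ≤ ∑ t ∈ Finset.range T, M.incrementBound p₀ η lam t (history M x θ r t ω)
          (x t ω, M.greedy (θ t ω) (x t ω), r t ω) := by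
  induction T with
  | zero => simp [logPartition]
  | succ t ih =>
    rw [Finset.sum_range_succ]
    exact (M.log_partition_succ_le (p₀ := p₀) hopt hB hη hlam t
      (history M x θ r (t + 1) ω)).trans (add_le_add_left ih _)

namespace IsFeelGoodTS

variable {X A Θ Ω : Type*} [MeasurableSpace X] [MeasurableSpace A] [MeasurableSpace Θ]
  [MeasurableSpace Ω] {B : ContextualBandit X A} {M : ValueModel B Θ}
  {p₀ : Measure Θ} [IsProbabilityMeasure p₀] {η lam : ℝ} {T : ℕ} {P : Measure Ω}
  {x : ℕ → Ω → X} {θ : ℕ → Ω → Θ} {r : ℕ → Ω → ℝ}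
  [IsProbabilityMeasure P] [IsMarkovKernel B.reward]
  (hrun : IsFeelGoodTS M p₀ η lam 1 T P x θ r)
  (hopt : Measurable B.optValue) (hB : B.RewardAssumption) (hη : 0 < η) (hlam : 0 < lam)
include hrun hopt

omit [IsProbabilityMeasure P] in
theorem measurable_logPartition :
    Measurable (logPartition M x θ r p₀ η lam 1 T) :=
  Real.measurable_log.comp
    ((M.measurable_partition hopt T).comp (hrun.measurable_history le_rfl))

include hB hη hlam

theorem sum_expReg_le [MeasurableSingletonClass A] {K : ℕ}
    (hK : ∀ y, (B.actions y).encard ≤ K) :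
    ∑ t ∈ Finset.range T, expReg M P x θ t
      ≤ lam * K * T / η
        + (1 / 4 * η / lam) * ∑ t ∈ Finset.range T, expLS M P x θ r p₀ η lam 1 t
        - ∑ t ∈ Finset.range T, expFG M P x θ 1 t := by
  refine (Finset.sum_le_sum fun t ht =>
    hrun.expReg_le hopt hB hη hlam hK (Finset.mem_range.1 ht)).trans_eq ?_
  rw [Finset.sum_sub_distrib, Finset.sum_add_distrib, ← Finset.mul_sum, Finset.sum_const,
    Finset.card_range, nsmul_eq_mul]
  ring

/-- The log-partition function has an integrable majorant whose expectation controls the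
least-squares and Feel-Good terms. -/
theorem exists_integrable_majorant (hη' : η ≤ 1 / 4) (k : ℝ) :
    ∃ H : Ω → ℝ, Integrable H P ∧ (∀ ω, logPartition M x θ r p₀ η lam 1 T ω ≤ H ω) ∧
      k + (1 / 4 * η / lam) * ∑ t ∈ Finset.range T, expLS M P x θ r p₀ η lam 1 t
        - ∑ t ∈ Finset.range T, expFG M P x θ 1 t
      ≤ k + 6 * lam * T - 1 / lam * ∫ ω, H ω ∂P := by
  have hinc := fun t (ht : t ∈ Finset.range T) =>
    hrun.integrable_and_integral_incrementBound_le hopt hB hη hlam hη' (Finset.mem_range.1 ht)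
  refine ⟨_, integrable_finsetSum _ fun t ht => (hinc t ht).1,
    fun ω => M.logPartition_le_sum_incrementBound hopt hB hη hlam T ω, ?_⟩
  rw [integral_finsetSum _ fun t ht => (hinc t ht).1]
  have hsum := Finset.sum_le_sum fun t ht => (hinc t ht).2
  rw [Finset.sum_add_distrib, Finset.sum_add_distrib, Finset.sum_neg_distrib, ← Finset.mul_sum,
    ← Finset.mul_sum, Finset.sum_const, Finset.card_range, nsmul_eq_mul] at hsum
  set D := ∑ t ∈ Finset.range T, ∫ ω, M.incrementBound p₀ η lam t (history M x θ r t ω)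
    (x t ω, M.greedy (θ t ω) (x t ω), r t ω) ∂P
  set L := ∑ t ∈ Finset.range T, expLS M P x θ r p₀ η lam 1 t
  set F := ∑ t ∈ Finset.range T, expFG M P x θ 1 t
  have hT : (0 : ℝ) ≤ T := T.cast_nonneg
  have h1 : 1 / lam * D ≤ 1 / lam * (-(η / 4 * L) + lam * F + T * (9 / 4 * lam ^ 2)) := by
    gcongr
  have h2 : 1 / lam * (-(η / 4 * L) + lam * F + T * (9 / 4 * lam ^ 2))
      = -(1 / 4 * η / lam * L) + F + 9 / 4 * (lam * T) := by
    field_simp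
  have h3 : 0 ≤ lam * T := by positivity
  linarith

/-- Under approximate realizability by a parameter of prior mass `1/N`, the log-partition
function has an integrable minorant with an explicit expectation: keep only that parameter in the
prior average; the cross terms with the noise have mean zero. -/
theorem exists_integrable_minorant {N : ℕ} (hN : 0 < N) {δ : ℝ} {θstar : Θ}
    (hsing : MeasurableSet {θstar}) (hp : p₀ {θstar} = (N : ℝ≥0∞)⁻¹)
    (hδ : ∀ y, ∀ a ∈ B.actions y, |M.f θstar y a - B.fstar y a| ≤ δ) :
    ∃ G : Ω → ℝ, Integrable G P ∧ (∀ ω, G ω ≤ logPartition M x θ r p₀ η lam 1 T ω) ∧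
      ∫ ω, G ω ∂P = -Real.log N - T * (η * δ ^ 2 + lam * δ) := by
  set ψ : X × A → ℝ := fun p => M.f θstar p.1 p.2 - B.fstar p.1 p.2 with hψ
  have hψm : Measurable ψ :=
    (M.measurable_f.comp (f := fun p : X × A => (θstar, p)) (by fun_prop)).sub B.measurable_fstar
  set n : ℕ → Ω → ℝ := fun t ω => ψ (x t ω, M.greedy (θ t ω) (x t ω))
    * (r t ω - B.fstar (x t ω) (M.greedy (θ t ω) (x t ω))) with hn
  have hnoise := fun t (ht : t ∈ Finset.range T) =>
    hrun.integrable_mul_noise_and_integral_eq_zero hB hψm hδ (Finset.mem_range.1 ht)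
  have hni : Integrable (fun ω => ∑ t ∈ Finset.range T, n t ω) P :=
    integrable_finsetSum _ fun t ht => (hnoise t ht).1
  refine ⟨fun ω => (-Real.log N - T * (η * δ ^ 2 + lam * δ))
      + 2 * η * ∑ t ∈ Finset.range T, n t ω,
    (integrable_const _).add (hni.const_mul _), fun ω => ?_, ?_⟩
  · have hexc : ∀ t, M.excessLoss η lam 1 θstar (x t ω, M.greedy (θ t ω) (x t ω), r t ω)
        ≤ (η * δ ^ 2 + lam * δ) - 2 * η * n t ω := by
      intro t
      have ha := M.greedy_mem (θ t ω) (x t ω)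
      have hg := hδ _ _ ha
      have hsq : (M.f θstar (x t ω) (M.greedy (θ t ω) (x t ω))
          - B.fstar (x t ω) (M.greedy (θ t ω) (x t ω))) ^ 2 ≤ δ ^ 2 := by
        rw [← sq_abs]
        gcongr
      have hδ0 : 0 ≤ δ := (abs_nonneg _).trans hg
      have hopt1 := (hB.optValue_mem_Icc ha).2
      have hval : B.optValue (x t ω) ≤ M.value θstar (x t ω) + δ := by
        refine csSup_le ⟨_, _, ha, rfl⟩ ?_
        rintro _ ⟨a', ha', rfl⟩
        have h1 := (abs_le.1 (hδ _ a' ha')).1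
        have h2 := M.greedy_max θstar _ a' ha'
        unfold ValueModel.value
        linarith
      have hmin : B.optValue (x t ω) - δ ≤ min 1 (M.value θstar (x t ω)) :=
        le_min (by linarith) (by linarith)
      have h3 : lam * (-δ) ≤ lam * (min 1 (M.value θstar (x t ω)) - B.optValue (x t ω)) := by
        gcongr
        linarith
      have h4 := mul_le_mul_of_nonneg_left hsq hη.le
      simp only [ValueModel.excessLoss, hn, hψ]
      nlinarith
    have hsum : ∑ s, M.excessLoss η lam 1 θstar (history M x θ r T ω s)
        ≤ T * (η * δ ^ 2 + lam * δ) - 2 * η * ∑ t ∈ Finset.range T, n t ω := by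
      change ∑ s : Fin T, M.excessLoss η lam 1 θstar
        (x s ω, M.greedy (θ s ω) (x s ω), r s ω) ≤ _
      rw [Fin.sum_univ_eq_sum_range (fun t => M.excessLoss η lam 1 θstar
        (x t ω, M.greedy (θ t ω) (x t ω), r t ω))]
      refine (Finset.sum_le_sum fun t _ => hexc t).trans_eq ?_
      rw [Finset.sum_sub_distrib, Finset.sum_const, Finset.card_range, nsmul_eq_mul,
        ← Finset.mul_sum]
    have hi := M.integrable_exp_neg_sum_excessLoss (p₀ := p₀) (b := 1) hopt hη hlam T
      (history M x θ r T ω)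
    have hNr : (0 : ℝ) < N := by exact_mod_cast hN
    have hZ : (N : ℝ)⁻¹ * Real.exp (-∑ s, M.excessLoss η lam 1 θstar (history M x θ r T ω s))
        ≤ ∫ θ', Real.exp (-∑ s, M.excessLoss η lam 1 θ' (history M x θ r T ω s)) ∂p₀ := by
      refine le_trans (le_of_eq ?_)
        (setIntegral_le_integral (s := {θstar}) hi (.of_forall fun θ' => (Real.exp_pos _).le))
      rw [setIntegral_congr_fun hsing (g := fun _ =>
        Real.exp (-∑ s, M.excessLoss η lam 1 θstar (history M x θ r T ω s)))
        (by rintro _ rfl; rfl), setIntegral_const, measureReal_def, hp]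
      simp
    have hlog := Real.log_le_log (by positivity) hZ
    rw [Real.log_mul (by positivity) (Real.exp_pos _).ne', Real.log_inv, Real.log_exp] at hlog
    unfold logPartition
    linarith
  · rw [integral_const_add_mul hni, integral_finsetSum _ fun t ht => (hnoise t ht).1,
      Finset.sum_eq_zero fun t ht => (hnoise t ht).2, mul_zero, add_zero]

theorem sum_expReg_le_of_approx_realizable [MeasurableSingletonClass A] {K : ℕ}
    (hK : ∀ y, (B.actions y).encard ≤ K) (hη' : η ≤ 1 / 4) {N : ℕ} (hN : 0 < N) {δ : ℝ}
    {θstar : Θ} (hsing : MeasurableSet {θstar}) (hp : p₀ {θstar} = (N : ℝ≥0∞)⁻¹)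
    (hδ : ∀ y, ∀ a ∈ B.actions y, |M.f θstar y a - B.fstar y a| ≤ δ) :
    ∑ t ∈ Finset.range T, expReg M P x θ t
      ≤ lam * K * T / η + 6 * lam * T + (Real.log N + T * (η * δ ^ 2 + lam * δ)) / lam := by
  obtain ⟨H, hHi, hH, hle⟩ :=
    hrun.exists_integrable_majorant hopt hB hη hlam hη' (lam * K * T / η)
  obtain ⟨G, hGi, hG, hGe⟩ :=
    hrun.exists_integrable_minorant hopt hB hη hlam hN hsing hp hδ
  have hGH : ∫ ω, G ω ∂P ≤ ∫ ω, H ω ∂P := integral_mono hGi hHi fun ω => (hG ω).trans (hH ω)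
  rw [hGe] at hGH
  have h1 := mul_le_mul_of_nonneg_left hGH (one_div_nonneg.2 hlam.le)
  have h2 : 1 / lam * (-Real.log N - T * (η * δ ^ 2 + lam * δ))
      = -((Real.log N + T * (η * δ ^ 2 + lam * δ)) / lam) := by ring
  linarith [hrun.sum_expReg_le hopt hB hη hlam hK]

end IsFeelGoodTS

/-! ### Tuning the parameter `λ` -/

/-- With `c = √(L / (4kT))`, the two terms `4kTc` and `L / c` of the regret bound are balanced:
both equal `2 √(kTL)`. -/
theorem balanced_sqrt {k T L : ℝ} (hk : 0 < k) (hT : 0 < T) (hL : 0 ≤ L) :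
    4 * k * T * √(L / (4 * k * T)) = 2 * √(k * T * L) ∧
      2 * √(k * T * L) * √(L / (4 * k * T)) = L := by
  have hR : √(L / (4 * k * T)) = √(k * T * L) / (2 * k * T) := by
    rw [← Real.sqrt_sq (by positivity : 0 ≤ 2 * k * T), ← Real.sqrt_div (by positivity)]
    congr 1
    field_simp
    ring
  have hs : √(k * T * L) ^ 2 = k * T * L := Real.sq_sqrt (by positivity)
  rw [hR]
  constructor
  · field_simp
    ring
  · field_simp
    linarith

theorem tuned_bound_le {K T L lam δ a : ℝ} (hK : 0 ≤ K) (hT : 0 < T) (hL : 0 ≤ L)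
    (hlam : 0 < lam) (ha : 0 ≤ a) (hlam' : lam = a + √(L / (4 * (K + 2) * T))) :
    lam * K * T / (1 / 4) + 6 * lam * T + (L + T * (1 / 4 * δ ^ 2 + lam * δ)) / lam
      ≤ 4 * √((K + 2) * T * L) + 4 * (K + 2) * T * a + T * δ + T * δ ^ 2 / (4 * lam) := by
  obtain ⟨h1, h2⟩ := balanced_sqrt (k := K + 2) (by linarith) hT hL
  set c := √(L / (4 * (K + 2) * T)) with hc
  set R := √((K + 2) * T * L) with hR
  have hR0 : 0 ≤ R := Real.sqrt_nonneg _
  have hLlam : L / lam ≤ 2 * R := by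
    rw [div_le_iff₀ hlam, hlam']
    nlinarith [mul_nonneg hR0 ha]
  have hsplit : (L + T * (1 / 4 * δ ^ 2 + lam * δ)) / lam
      = L / lam + T * δ + T * δ ^ 2 / (4 * lam) := by
    field_simp
    ring
  have hlin : lam * K * T / (1 / 4) + 6 * lam * T ≤ 4 * (K + 2) * T * lam := by
    have : 0 ≤ lam * T := by positivity
    nlinarith
  have hexp : 4 * (K + 2) * T * lam = 4 * (K + 2) * T * a + 2 * R := by
    rw [← h1, hlam']
    ring
  rw [hsplit]
  linarith

theorem tuned_bound_le_of_approx {K T L lam δ δ' : ℝ} (hK : 0 ≤ K) (hT : 0 < T) (hL : 0 ≤ L)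
    (hlam : 0 < lam) (hδ : 0 ≤ δ) (hδ' : 0 < δ')
    (hlam' : lam = δ' / √(K + 2) + √(L / (4 * (K + 2) * T))) :
    lam * K * T / (1 / 4) + 6 * lam * T + (L + T * (1 / 4 * δ ^ 2 + lam * δ)) / lam
      ≤ 4 * √((K + 2) * T * L) + 4 * (δ + δ' + δ ^ 2 / δ') * √(K + 2) * T := by
  have hs1 : 1 ≤ √(K + 2) := Real.one_le_sqrt.2 (by linarith)
  have hsq : √(K + 2) ^ 2 = K + 2 := Real.sq_sqrt (by linarith)
  set s := √(K + 2) with hs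
  have hs0 : 0 < s := by linarith
  have ha : 0 < δ' / s := by positivity
  refine (tuned_bound_le hK hT hL hlam ha.le hlam').trans ?_
  have h1 : 4 * (K + 2) * T * (δ' / s) = 4 * δ' * s * T := by
    rw [← hsq]
    field_simp
  have h2 : T * δ ^ 2 / (4 * lam) ≤ δ ^ 2 / δ' * s * T := by
    have hle : δ' / s ≤ 4 * lam := by
      rw [hlam']
      linarith [Real.sqrt_nonneg (L / (4 * (K + 2) * T))]
    calc T * δ ^ 2 / (4 * lam) ≤ T * δ ^ 2 / (δ' / s) := by gcongr
      _ = δ ^ 2 / δ' * s * T := by field_simp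
  have h3 : T * δ ≤ δ * s * T := by nlinarith [mul_nonneg hT.le hδ]
  have h4 : 0 ≤ δ * s * T := by positivity
  have h5 : 0 ≤ δ ^ 2 / δ' * s * T := by positivity
  rw [h1]
  nlinarith

theorem mainTheorem2
    {X A Θ Ω : Type*} [MeasurableSpace X] [MeasurableSpace A] [MeasurableSingletonClass A]
    [MeasurableSpace Θ] [MeasurableSpace Ω]
    (B : ContextualBandit X A) [IsMarkovKernel B.reward]
    (hB : B.RewardAssumption) (hopt : Measurable B.optValue)
    (K : ℕ) (hK : ∀ x, (B.actions x).encard ≤ K)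
    (M : ValueModel B Θ) (p₀ : Measure Θ) [IsProbabilityMeasure p₀]
    (η lam : ℝ) (hη : 0 < η) (hη' : η ≤ 1 / 4) (hlam : 0 < lam) (T : ℕ)
    (P : Measure Ω) [IsProbabilityMeasure P]
    (x : ℕ → Ω → X) (θ : ℕ → Ω → Θ) (r : ℕ → Ω → ℝ)
    (hrun : IsFeelGoodTS M p₀ η lam 1 T P x θ r) :
    -- first inequality: reduction to online least squares
    (∑ t ∈ Finset.range T, expReg M P x θ t
      ≤ lam * K * T / η
        + (1 / 4 * η / lam) * ∑ t ∈ Finset.range T, expLS M P x θ r p₀ η lam 1 t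
        - ∑ t ∈ Finset.range T, expFG M P x θ 1 t) ∧
    -- the expected log-partition function is well defined, with values in `[-∞, ∞)`
    (AEMeasurable (logPartition M x θ r p₀ η lam 1 T) P ∧
      ∫⁻ ω, ENNReal.ofReal (logPartition M x θ r p₀ η lam 1 T ω) ∂P ≠ ⊤) ∧
    -- second inequality
    (((lam * K * T / η
        + (1 / 4 * η / lam) * ∑ t ∈ Finset.range T, expLS M P x θ r p₀ η lam 1 t
        - ∑ t ∈ Finset.range T, expFG M P x θ 1 t : ℝ) : EReal)
      ≤ ((lam * K * T / η + 6 * lam * T : ℝ) : EReal)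
        - ((1 / lam : ℝ) : EReal)
          * extExpectation P (logPartition M x θ r p₀ η lam 1 T)) ∧
    -- finite class of size `N`, uniform prior, approximate realizability
    (∀ (N : ℕ) (δ δ' : ℝ) (θstar : Θ),
      Finite Θ → Nat.card Θ = N → MeasurableSingletonClass Θ →
      (∀ ϑ : Θ, p₀ {ϑ} = (N : ℝ≥0∞)⁻¹) →
      1 ≤ T → 0 ≤ δ → δ ≤ 1 / 2 → 0 < δ' →
      (∀ y, ∀ a ∈ B.actions y, |M.f θstar y a - B.fstar y a| ≤ δ) →
      η = 1 / 4 →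
      lam = δ' / √(K + 2) + √(Real.log N / (4 * (K + 2) * T)) →
      ∑ t ∈ Finset.range T, expReg M P x θ t
        ≤ 4 * √((K + 2) * T * Real.log N)
          + 4 * (δ + δ' + δ ^ 2 / δ') * √(K + 2) * T) ∧
    -- finite class of size `N`, uniform prior, exact realizability: regret `O(√(K T ln N))`
    (∀ (N : ℕ) (θstar : Θ),
      Finite Θ → Nat.card Θ = N → MeasurableSingletonClass Θ →
      (∀ ϑ : Θ, p₀ {ϑ} = (N : ℝ≥0∞)⁻¹) →
      1 ≤ T → 2 ≤ N →
      (∀ y, ∀ a ∈ B.actions y, M.f θstar y a = B.fstar y a) →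
      η = 1 / 4 →
      lam = √(Real.log N / (4 * (K + 2) * T)) →
      ∑ t ∈ Finset.range T, expReg M P x θ t ≤ 4 * √((K + 2) * T * Real.log N) ∧
      ∑ t ∈ Finset.range T, expReg M P x θ t ≤ 4 * √3 * √(K * T * Real.log N)) := by
  have : Nonempty Ω := P.nonempty_of_neZero
  refine ⟨hrun.sum_expReg_le hopt hB hη hlam hK, ?_, ?_, ?_, ?_⟩
  · obtain ⟨H, hHi, hH, -⟩ := hrun.exists_integrable_majorant hopt hB hη hlam hη' 0
    exact ⟨(hrun.measurable_logPartition hopt).aemeasurable,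
      lintegral_ofReal_ne_top_of_le hHi hH⟩
  · obtain ⟨H, hHi, hH, hle⟩ :=
      hrun.exists_integrable_majorant hopt hB hη hlam hη' (lam * K * T / η)
    have hext := extExpectation_le_integral (hrun.measurable_logPartition hopt).aemeasurable hHi hH
    have hlam' : (0 : EReal) ≤ ((1 / lam : ℝ) : EReal) := by
      exact_mod_cast (one_div_pos.2 hlam).le
    refine le_trans ?_ (EReal.sub_le_sub le_rfl (mul_le_mul_of_nonneg_left hext hlam'))
    exact_mod_cast hle
  · intro N δ δ' θstar _ hcard _ hp hT hδ _ hδ' hreal hηe hlame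
    subst hηe
    have hN : 0 < N := by
      rw [← hcard]
      have : Nonempty Θ := ⟨θstar⟩
      exact Nat.card_pos
    exact (hrun.sum_expReg_le_of_approx_realizable hopt hB hη hlam hK hη' hN
      (measurableSet_singleton θstar) (hp θstar) hreal).trans
      (tuned_bound_le_of_approx K.cast_nonneg (by exact_mod_cast hT) (Real.log_natCast_nonneg N)
        hlam hδ hδ' hlame)
  · intro N θstar _ hcard _ hp hT hN hreal hηe hlame
    subst hηe
    have hTr : (0 : ℝ) < T := by exact_mod_cast hT
    have hL := Real.log_natCast_nonneg N
    have h0 : ∀ y, ∀ a ∈ B.actions y, |M.f θstar y a - B.fstar y a| ≤ 0 := fun y a ha => by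
      simp [hreal y a ha]
    have hmain : ∑ t ∈ Finset.range T, expReg M P x θ t ≤ 4 * √((K + 2) * T * Real.log N) := by
      refine (hrun.sum_expReg_le_of_approx_realizable hopt hB hη hlam hK hη' (by omega)
        (measurableSet_singleton θstar) (hp θstar) h0).trans ?_
      refine (tuned_bound_le (a := 0) K.cast_nonneg hTr hL hlam le_rfl
        (by rw [hlame, zero_add])).trans_eq ?_
      simp
    refine ⟨hmain, hmain.trans ?_⟩
    -- Some action is available, so that `K ≥ 1` and `K + 2 ≤ 3K`.
    have hK1 : (1 : ℝ) ≤ K := by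
      obtain ⟨ω⟩ := ‹Nonempty Ω›
      have h1 : (1 : ℕ∞) ≤ (B.actions (x 0 ω)).encard :=
        Set.one_le_encard_iff_nonempty.2 ⟨_, M.greedy_mem θstar (x 0 ω)⟩
      exact_mod_cast h1.trans (hK (x 0 ω))
    rw [mul_assoc 4 √3, ← Real.sqrt_mul (by norm_num)]
    refine mul_le_mul_of_nonneg_left (Real.sqrt_le_sqrt ?_) (by norm_num)
    have h2 : 0 ≤ T * Real.log N := by positivity
    nlinarith
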